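/- Let $r\ge 1$ be an integer. For $d\ge 1$ let $\mathcal C^r_d$ be the class of all $r$ times continuously differentiable functions $f:[0,1]^d\to\mathbb R$ all of whose partial derivatives satisfy $\Vert D^\beta f\Vert_\infty\le 1$ for $|\beta|\le r$. For $\varepsilon>0$ let $n^{\rm app}(\varepsilon,\mathcal C^r_d)$ (resp. $n^{\rm int}(\varepsilon,\mathcal C^r_d)$) be the minimal number $n$ such that the infimum of the worst case errors $\sup_{f\in\mathcal C^r_d}\Vert f-A(f)\Vert_{L_\infty([0,1]^d)}$ (resp. $\sup_{f\in\mathcal C^r_d}|A(f)-\int_{[0,1]^d}f(x)\,dx|$), over all deterministic algorithms $A$ that use at most $n$ (adaptively chosen) function values, is at most $\varepsilon$. Here $A=\varphi\circ N$, where $N(f)=(f(x_1),\dots,f(x_m))$ with $m\le n$, each point $x_i\in[0,1]^d$ may depend on $f(x_1),\dots,f(x_{i-1})$, and $\varphi$ is an arbitrary map from $\mathbb R^m$ to $L_\infty([0,1]^d)$ (resp. to $\mathbb R$). Uniform recovery on $\mathcal C^r_d$ is called significantly harder than integration on $\mathcal C^r_d$ if there is $\varepsilon_0>0$ such that for every $K>0$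 there is $d_0$ with $$n^{\rm app}(\varepsilon,\mathcal C^r_d)\ \ge\ K^d\, n^{\rm int}(\varepsilon,\mathcal C^r_d)\qquad\text{for all } d\ge d_0,\ \varepsilon\in(0,\varepsilon_0).$$ Then uniform recovery on $\mathcal C^r_d$ is significantly harder than integration on $\mathcal C^r_d$ if and only if $r\ge 3$. More precisely: 1. Integration has complexity of order $(d/\varepsilon)^{d/r}$: there are $c_r,C_r>0$ such that $$\bigl(c_r d^{1/r}\varepsilon^{-1/r}\bigr)^d\le n^{\rm int}(\varepsilon,\mathcal C^r_d)\le \bigl(C_r d^{1/r}\varepsilon^{-1/r}\bigr)^d\qquad\text{for all } d\ge 1,\ \varepsilon\in(0,1/2).$$ 2. If $r\ge 3$, there are $c_r',\varepsilon_r>0$ such that $$n^{\rm app}(\varepsilon,\mathcal C^r_d)\ge \bigl(c_r'\, d^{1/2-1/r}\bigr)^d\, n^{\rm int}(\varepsilon,\mathcal C^r_d)\qquad\text{for all } d\ge 1,\ \varepsilon\in(0,\varepsilon_r).$$ 3. If $r\in\{1,2\}$, the two complexities are of the same order: there is $C_r'>0$ such that $$n^{\rm int}(\varepsilon,\mathcal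 C^r_d)\le n^{\rm app}(\varepsilon,\mathcal C^r_d)\le (C_r')^d\, n^{\rm int}(\varepsilon,\mathcal C^r_d)\qquad\text{for all } d\ge 1,\ \varepsilon\in(0,1/2).$$ -/

import Mathlib

open MeasureTheory
open scoped ENNReal

noncomputable section

namespace UniformRecovery

/-- The unit cube `[0,1]^d`. -/
def cube (d : ℕ) : Set (Fin d → ℝ) := Set.Icc 0 1

/-- The partial derivative of `f` on the cube in the coordinate directions `i 0, …, i (k-1)`
(one-sided where necessary at the boundary). -/
def partialDeriv {d k : ℕ} (f : (Fin d → ℝ) → ℝ) (i : Fin k → Fin d) (x : Fin d → ℝ) : ℝ :=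
  iteratedFDerivWithin ℝ k f (cube d) x (fun j => Pi.single (i j) 1)

/-- The class of all `r` times continuously differentiable functions on the unit cube all of whose
partial derivatives of order at most `r` (including `f` itself) are bounded by one.  A function on
the cube is represented by any extension to `ℝ^d`; only its values on the cube are ever used. -/
def smoothClass (r d : ℕ) : Set ((Fin d → ℝ) → ℝ) :=
  {f | ContDiffOn ℝ r f (cube d) ∧
    ∀ k ≤ r, ∀ i : Fin k → Fin d, ∀ x ∈ cube d, |partialDeriv f i x| ≤ 1}

/-- A rule for the adaptive choice of nodes in the cube: the node with index `i` may depend on the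
`i` function values that have already been computed. -/
structure NodeRule (d : ℕ) where
  node : (i : ℕ) → (Fin i → ℝ) → (Fin d → ℝ)
  node_mem : ∀ i y, node i y ∈ cube d

/-- The information map `N(f) = (f(x_1), …, f(x_n))` with adaptively chosen nodes. -/
def NodeRule.info {d : ℕ} (N : NodeRule d) (f : (Fin d → ℝ) → ℝ) : (n : ℕ) → (Fin n → ℝ)
  | 0 => Fin.elim0
  | n + 1 => Fin.snoc (α := fun _ => ℝ) (N.info f n) (f (N.node n (N.info f n)))

/-- The space `L_∞([0,1]^d)`. -/
abbrev LInfty (d : ℕ) : Type := Lp ℝ ∞ (volume.restrict (cube d))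

/-- The worst case error on `F` of the approximation algorithm `φ ∘ N` of cost `n`. -/
def appError {d n : ℕ} (F : Set ((Fin d → ℝ) → ℝ)) (N : NodeRule d)
    (φ : (Fin n → ℝ) → LInfty d) : ℝ≥0∞ :=
  ⨆ f ∈ F, eLpNorm (fun x => f x - φ (N.info f n) x) ∞ (volume.restrict (cube d))

/-- The worst case error on `F` of the integration algorithm `φ ∘ N` of cost `n`. -/
def intError {d n : ℕ} (F : Set ((Fin d → ℝ) → ℝ)) (N : NodeRule d)
    (φ : (Fin n → ℝ) → ℝ) : ℝ≥0∞ :=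
  ⨆ f ∈ F, ENNReal.ofReal |φ (N.info f n) - ∫ x in cube d, f x|

/-- The `n`th minimal worst case error of uniform approximation. -/
def minAppError {d : ℕ} (n : ℕ) (F : Set ((Fin d → ℝ) → ℝ)) : ℝ≥0∞ :=
  ⨅ (m : ℕ) (_ : m ≤ n) (N : NodeRule d) (φ : (Fin m → ℝ) → LInfty d), appError F N φ

/-- The `n`th minimal worst case error of integration. -/
def minIntError {d : ℕ} (n : ℕ) (F : Set ((Fin d → ℝ) → ℝ)) : ℝ≥0∞ :=
  ⨅ (m : ℕ) (_ : m ≤ n) (N : NodeRule d) (φ : (Fin m → ℝ) → ℝ), intError F N φ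

/-- The minimal number of function values for uniform approximation on `F` up to error `ε`. -/
def nApp {d : ℕ} (ε : ℝ) (F : Set ((Fin d → ℝ) → ℝ)) : ℕ :=
  sInf {n : ℕ | minAppError n F ≤ ENNReal.ofReal ε}

/-- The minimal number of function values for integration on `F` up to error `ε`. -/
def nInt {d : ℕ} (ε : ℝ) (F : Set ((Fin d → ℝ) → ℝ)) : ℕ :=
  sInf {n : ℕ | minIntError n F ≤ ENNReal.ofReal ε}

/-- A problem with complexity `p d ε` is significantly harder than one with complexity `q d ε`:
orders of complexity being measured up to factors `K ^ d`, the first complexity eventually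
dominates the second one by every such factor, uniformly in the small error tolerances `ε`. -/
def SignificantlyHarder (p q : ℕ → ℝ → ℕ) : Prop :=
  ∃ ε₀ : ℝ, 0 < ε₀ ∧ ∀ K : ℝ, 0 < K → ∃ d₀ : ℕ, ∀ d : ℕ, d₀ ≤ d → ∀ ε : ℝ, 0 < ε → ε < ε₀ →
    K ^ d * (q d ε : ℝ) ≤ (p d ε : ℝ)

end UniformRecovery

end

namespace UniformRecovery

/-! ### The unit cube -/

/-! Up to factors `C ^ d`, integration costs `(d / ε) ^ (d / r)`, while recovery needs at least `(√d
* ε ^ (-1 / r)) ^ d` points. The quotient is `d ^ (1 / 2 - 1 / r)` to the power `d`, which beats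
every `K ^ d` exactly when `r ≥ 3`.

Upper bounds. Take a univariate rule with nonnegative weights of sum one and error `O(m ^ (-r))`,
and form its tensor product. The product is still an average, so univariate errors add up and the
total is only `d` times the univariate error (`abs_integral_pi_sub_tensorRule_le`). For integration,
positive rules of every order exist by convexity (`exists_quadrature`). For recovery with `r ≤ 2`,
piecewise linear interpolation has nonnegative weights; point evaluation is integration against a
product of Dirac measures, so the same lemma applies.

Lower bounds. A symmetric pair `f`, `-f` vanishing at the nodes used for the zero function fools
every algorithm, adaptive or not. For integration, a Lipschitz ramp in the `ℓ₁` distance to the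
nodes is mollified at scale `η` in each coordinate. The result vanishes at the nodes and equals `2 *
ε` outside `ℓ₁`-balls of radius about `d * η`, where `η ^ r = ε / d` (`exists_fooling_integration`).
Such balls have volume at most `(C * η) ^ d`, so fewer than `(c / η) ^ d` of them leave most of the
cube uncovered. For recovery a single peak suffices: a radial bump on a Euclidean ball of radius `ρ`
may have height of order `ρ ^ r` with a constant free of `d` (`exists_fooling_recovery`), and this
ball has volume at most `(C * ρ / √d) ^ d`. -/

theorem mem_cube {d : ℕ} {x : Fin d → ℝ} : x ∈ cube d ↔ ∀ j, x j ∈ Set.Icc (0 : ℝ) 1 :=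
  ⟨fun h j => ⟨h.1 j, h.2 j⟩, fun h => ⟨fun j => (h j).1, fun j => (h j).2⟩⟩

theorem cube_eq_pi (d : ℕ) : cube d = Set.univ.pi fun _ => Set.Icc (0 : ℝ) 1 := by
  ext x; simp only [mem_cube, Set.mem_univ_pi]

theorem isCompact_cube (d : ℕ) : IsCompact (cube d) := isCompact_Icc

theorem measurableSet_cube (d : ℕ) : MeasurableSet (cube d) := measurableSet_Icc

theorem zero_mem_cube (d : ℕ) : (0 : Fin d → ℝ) ∈ cube d := by simp [cube]

theorem volume_cube (d : ℕ) : volume (cube d) = 1 := by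
  rw [cube_eq_pi, volume_pi_pi]
  simp

instance (d : ℕ) : IsProbabilityMeasure (volume.restrict (cube d)) :=
  ⟨by simp [volume_cube]⟩

theorem uniqueDiffOn_cube (d : ℕ) : UniqueDiffOn ℝ (cube d) := by
  rw [cube_eq_pi]
  exact UniqueDiffOn.univ_pi fun _ => uniqueDiffOn_Icc zero_lt_one

/-! ### Algorithms -/

/-- The rule using prescribed nodes. -/
def NodeRule.fixed {d : ℕ} (x : ℕ → Fin d → ℝ) (hx : ∀ i, x i ∈ cube d) : NodeRule d where
  node i _ := x i
  node_mem i _ := hx i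

theorem NodeRule.info_fixed {d : ℕ} (x : ℕ → Fin d → ℝ) (hx : ∀ i, x i ∈ cube d)
    (f : (Fin d → ℝ) → ℝ) (n : ℕ) :
    (NodeRule.fixed x hx).info f n = fun i : Fin n => f (x i) := by
  induction n with
  | zero => funext i; exact i.elim0
  | succ n ih =>
    funext i
    refine Fin.lastCases ?_ (fun i => ?_) i
    · simp [NodeRule.info, NodeRule.fixed]
    · simp [NodeRule.info, ih]

/-- Adaptivity gives no protection against fooling functions: as long as only zeros are observed,
the rule keeps choosing the nodes it would choose for the zero function. -/
theorem NodeRule.info_eq_info_zero {d : ℕ} (N : NodeRule d) (f : (Fin d → ℝ) → ℝ) (n : ℕ)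
    (hf : ∀ i < n, f (N.node i (N.info (fun _ => 0) i)) = 0) :
    N.info f n = N.info (fun _ => 0) n := by
  induction n with
  | zero => rfl
  | succ n ih =>
    have h := ih fun i hi => hf i (hi.trans n.lt_succ_self)
    simp only [NodeRule.info, h, hf n n.lt_succ_self]

/-- The algorithm returns the same number for `f` and `-f`. According to its sign, it misses one of
the two integrals by at least `E`. -/
theorem ofReal_le_minIntError {d n : ℕ} {F : Set ((Fin d → ℝ) → ℝ)} {E : ℝ}
    (h : ∀ m ≤ n, ∀ x : Fin m → Fin d → ℝ, ∃ f ∈ F, (fun y => -f y) ∈ F ∧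
      (∀ i, f (x i) = 0) ∧ E ≤ ∫ y in cube d, f y) :
    ENNReal.ofReal E ≤ minIntError n F := by
  refine le_iInf fun m => le_iInf fun hm => le_iInf fun N => le_iInf fun φ => ?_
  obtain ⟨f, hf, hf', hfx, hE⟩ := h m hm fun i => N.node i (N.info (fun _ => 0) i)
  have h1 := N.info_eq_info_zero f m fun i hi => hfx ⟨i, hi⟩
  have h2 := N.info_eq_info_zero (fun y => -f y) m fun i hi => by
    simpa using hfx ⟨i, hi⟩
  set a := φ (N.info (fun _ => 0) m)
  rcases le_total a 0 with ha | ha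
  · refine le_trans ?_ (le_iSup₂ (f := fun f (_ : f ∈ F) =>
      ENNReal.ofReal |φ (N.info f m) - ∫ x in cube d, f x|) f hf)
    refine ENNReal.ofReal_le_ofReal ?_
    rw [h1, abs_sub_comm]
    exact le_trans (by linarith) (le_abs_self _)
  · refine le_trans ?_ (le_iSup₂ (f := fun f (_ : f ∈ F) =>
      ENNReal.ofReal |φ (N.info f m) - ∫ x in cube d, f x|) _ hf')
    refine ENNReal.ofReal_le_ofReal ?_
    rw [h2, integral_neg]
    exact le_trans (by linarith) (le_abs_self _)

/-- If the common output were closer than `E` to both `f` and `-f` almost everywhere, averaging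
would give `f < E` almost everywhere. Positive measure of the peak is required because the error is
an essential supremum. -/
theorem ofReal_le_minAppError {d n : ℕ} {F : Set ((Fin d → ℝ) → ℝ)} {E : ℝ}
    (h : ∀ m ≤ n, ∀ x : Fin m → Fin d → ℝ, ∃ f ∈ F, (fun y => -f y) ∈ F ∧
      (∀ i, f (x i) = 0) ∧ volume.restrict (cube d) {y | E ≤ f y} ≠ 0) :
    ENNReal.ofReal E ≤ minAppError n F := by
  refine le_iInf fun m => le_iInf fun hm => le_iInf fun N => le_iInf fun φ => ?_
  obtain ⟨f, hf, hf', hfx, hE⟩ := h m hm fun i => N.node i (N.info (fun _ => 0) i)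
  have h1 := N.info_eq_info_zero f m fun i hi => hfx ⟨i, hi⟩
  have h2 := N.info_eq_info_zero (fun y => -f y) m fun i hi => by
    simpa using hfx ⟨i, hi⟩
  by_contra! hlt
  have key : ∀ g ∈ F, ∀ᵐ x ∂(volume.restrict (cube d)),
      ENNReal.ofReal |g x - φ (N.info g m) x| < ENNReal.ofReal E := by
    intro g hg
    have h3 : eLpNorm (fun x => g x - φ (N.info g m) x) ∞ (volume.restrict (cube d)) <
        ENNReal.ofReal E := lt_of_le_of_lt (le_iSup₂ (f := fun f (_ : f ∈ F) =>
      eLpNorm (fun x => f x - φ (N.info f m) x) ∞ (volume.restrict (cube d))) g hg) hlt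
    rw [eLpNorm_exponent_top] at h3
    filter_upwards [ae_lt_of_essSup_lt h3] with x hx
    rwa [← ofReal_norm, Real.norm_eq_abs] at hx
  apply hE
  have h3 := key f hf
  have h4 := key _ hf'
  rw [h1] at h3
  rw [h2] at h4
  have : ∀ᵐ x ∂(volume.restrict (cube d)), ¬ E ≤ f x := by
    filter_upwards [h3, h4] with x hx hx' hxE
    have a1 := (ENNReal.ofReal_lt_ofReal_iff_of_nonneg (abs_nonneg _)).1 hx
    have a2 := (ENNReal.ofReal_lt_ofReal_iff_of_nonneg (abs_nonneg _)).1 hx'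
    rw [abs_lt] at a1 a2
    linarith [a1.2, a2.1]
  simpa [ae_iff] using this

/-! ### Upper bounds from explicit nonadaptive algorithms -/

theorem exists_nodes_of_fintype {d : ℕ} {ι : Type*} [Fintype ι] (x : ι → Fin d → ℝ)
    (hx : ∀ i, x i ∈ cube d) : ∃ (N : NodeRule d) (e : ι ≃ Fin (Fintype.card ι)),
      ∀ f : (Fin d → ℝ) → ℝ, (fun i => N.info f (Fintype.card ι) (e i)) = fun i => f (x i) := by
  classical
  let e := Fintype.equivFin ι
  -- A node rule must name a node for every index; the origin fills the indices beyond the cost.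
  have hz : ∀ i : ℕ, (if h : i < Fintype.card ι then x (e.symm ⟨i, h⟩) else 0) ∈ cube d := by
    intro i
    split_ifs with h
    · exact hx _
    · exact zero_mem_cube d
  refine ⟨NodeRule.fixed _ hz, e, fun f => ?_⟩
  funext i
  rw [NodeRule.info_fixed]
  simp

theorem minIntError_le {d : ℕ} {ι : Type*} [Fintype ι] {F : Set ((Fin d → ℝ) → ℝ)} {E : ℝ}
    (x : ι → Fin d → ℝ) (hx : ∀ i, x i ∈ cube d) (φ : (ι → ℝ) → ℝ)
    (h : ∀ f ∈ F, |φ (fun i => f (x i)) - ∫ y in cube d, f y| ≤ E) :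
    minIntError (Fintype.card ι) F ≤ ENNReal.ofReal E := by
  obtain ⟨N, e, hN⟩ := exists_nodes_of_fintype x hx
  refine iInf_le_of_le (Fintype.card ι) (iInf_le_of_le le_rfl (iInf_le_of_le N
    (iInf_le_of_le (fun y => φ fun i => y (e i)) (iSup₂_le fun f hf => ?_))))
  beta_reduce
  rw [hN]
  exact ENNReal.ofReal_le_ofReal (h f hf)

theorem minAppError_le {d : ℕ} {ι : Type*} [Fintype ι] {F : Set ((Fin d → ℝ) → ℝ)} {E : ℝ}
    (x : ι → Fin d → ℝ) (hx : ∀ i, x i ∈ cube d) (φ : (ι → ℝ) → (Fin d → ℝ) → ℝ)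
    (hφ : ∀ y, MemLp (φ y) ∞ (volume.restrict (cube d)))
    (h : ∀ f ∈ F, ∀ z ∈ cube d, |f z - φ (fun i => f (x i)) z| ≤ E) :
    minAppError (Fintype.card ι) F ≤ ENNReal.ofReal E := by
  obtain ⟨N, e, hN⟩ := exists_nodes_of_fintype x hx
  refine iInf_le_of_le (Fintype.card ι) (iInf_le_of_le le_rfl (iInf_le_of_le N
    (iInf_le_of_le (fun y => (hφ fun i => y (e i)).toLp) (iSup₂_le fun f hf => ?_))))
  beta_reduce
  simp only [hN]
  rw [eLpNorm_exponent_top]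
  refine eLpNormEssSup_le_of_ae_bound ?_
  filter_upwards [(hφ fun i => f (x i)).coeFn_toLp,
    ae_restrict_mem (measurableSet_cube d)] with z hz hzc
  rw [hz]
  exact h f hf z hzc

/-- Integrate the output of a recovery algorithm: on a probability space the `L₁` error is at most
the `L_∞` error. -/
theorem minIntError_le_minAppError {d n : ℕ} {F : Set ((Fin d → ℝ) → ℝ)}
    (hF : ∀ f ∈ F, IntegrableOn f (cube d)) : minIntError n F ≤ minAppError n F := by
  refine le_iInf fun m => le_iInf fun hm => le_iInf fun N => le_iInf fun φ => ?_
  refine iInf_le_of_le m (iInf_le_of_le hm (iInf_le_of_le N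
    (iInf_le_of_le (fun y => ∫ x in cube d, φ y x) (iSup₂_le fun f hf => ?_))))
  refine le_trans ?_ (le_iSup₂ (f := fun f (_ : f ∈ F) =>
      eLpNorm (fun x => f x - φ (N.info f m) x) ∞ (volume.restrict (cube d))) f hf)
  have hint : Integrable (φ (N.info f m)) (volume.restrict (cube d)) :=
    (Lp.memLp _).integrable le_top
  have hint' : Integrable f (volume.restrict (cube d)) := hF f hf
  rw [abs_sub_comm, ← integral_sub hint' hint, ← Real.norm_eq_abs]
  calc _ ≤ ENNReal.ofReal (∫ x in cube d, ‖f x - φ (N.info f m) x‖) :=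
        ENNReal.ofReal_le_ofReal (norm_integral_le_integral_norm _)
    _ = eLpNorm (fun x => f x - φ (N.info f m) x) 1 (volume.restrict (cube d)) := by
        rw [eLpNorm_one_eq_lintegral_enorm]
        exact ofReal_integral_norm_eq_lintegral_enorm (hint'.sub hint)
    _ ≤ _ := eLpNorm_le_eLpNorm_of_exponent_le le_top (hint'.sub hint).aestronglyMeasurable

/-! ### Properties of the smoothness class -/

theorem smoothClass_anti {r s d : ℕ} (h : r ≤ s) : smoothClass s d ⊆ smoothClass r d :=
  fun _ hf => ⟨hf.1.of_le (by exact_mod_cast h), fun k hk => hf.2 k (hk.trans h)⟩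

theorem integrableOn_of_mem_smoothClass {r d : ℕ} {f : (Fin d → ℝ) → ℝ}
    (hf : f ∈ smoothClass r d) : IntegrableOn f (cube d) :=
  hf.1.continuousOn.integrableOn_compact (isCompact_cube d)

/-- The univariate functions on the unit interval whose `r`th derivative is bounded by one. -/
def IntervalClass (r : ℕ) : Set (ℝ → ℝ) :=
  {g | ContDiffOn ℝ r g (Set.Icc 0 1) ∧
    ∀ t ∈ Set.Icc (0 : ℝ) 1, |iteratedDerivWithin r g (Set.Icc 0 1) t| ≤ 1}

theorem update_mem_cube {d : ℕ} {x : Fin d → ℝ} (hx : x ∈ cube d) (j : Fin d) {t : ℝ}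
    (ht : t ∈ Set.Icc (0 : ℝ) 1) : Function.update x j t ∈ cube d := by
  rw [mem_cube] at hx ⊢
  intro i
  rcases eq_or_ne i j with rfl | h
  · simpa using ht
  · simpa [h] using hx i

open scoped Pointwise in
theorem update_mem_intervalClass {r d : ℕ} {f : (Fin d → ℝ) → ℝ} (hf : f ∈ smoothClass r d)
    {x : Fin d → ℝ} (hx : x ∈ cube d) (j : Fin d) :
    (fun t => f (Function.update x j t)) ∈ IntervalClass r := by
  let L : ℝ →L[ℝ] (Fin d → ℝ) := ContinuousLinearMap.single ℝ (fun _ => ℝ) j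
  let z := Function.update x j 0
  have hL : ∀ t, z + L t = Function.update x j t := by
    intro t
    ext i
    rcases eq_or_ne i j with rfl | h
    · simp [z, L]
    · simp [z, L, h]
  -- Translating by `z` makes the line through `x` the image of the linear map `L`, so that the
  -- chain rule for linear maps applies to derivatives within sets.
  let s : Set (Fin d → ℝ) := -z +ᵥ cube d
  have hs : z +ᵥ s = cube d := by simp [s]
  have hms : ∀ y, y ∈ s ↔ z + y ∈ cube d := by
    intro y
    rw [← hs, ← vadd_eq_add, Set.vadd_mem_vadd_set_iff]
  have hsu : UniqueDiffOn ℝ s := by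
    have : s = Set.univ.pi fun i => Set.Icc (-z i) (-z i + 1) := by
      ext y
      rw [hms, mem_cube, Set.mem_univ_pi]
      refine forall_congr' fun i => ?_
      simp only [Set.mem_Icc, Pi.add_apply]
      constructor <;> rintro ⟨h1, h2⟩ <;> constructor <;> linarith
    rw [this]
    exact UniqueDiffOn.univ_pi fun i => uniqueDiffOn_Icc (by linarith)
  have hpre : L ⁻¹' s = Set.Icc 0 1 := by
    ext t
    rw [Set.mem_preimage, hms, hL]
    refine ⟨fun h => ?_, fun h => update_mem_cube hx j h⟩
    simpa using mem_cube.1 h j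
  have hc : ContDiffOn ℝ r (fun y => f (z + y)) s :=
    hf.1.comp (contDiff_const.add contDiff_id).contDiffOn fun y hy => (hms y).1 hy
  have hcomp : (fun t => f (Function.update x j t)) = (fun y => f (z + y)) ∘ L := by
    funext t; simp [hL]
  rw [hcomp]
  refine ⟨?_, fun t ht => ?_⟩
  · rw [← hpre]
    exact hc.comp L.contDiff.contDiffOn fun y hy => hy
  · rw [iteratedDerivWithin_eq_iteratedFDerivWithin, ← hpre,
      L.iteratedFDerivWithin_comp_right hc hsu (hpre ▸ uniqueDiffOn_Icc zero_lt_one)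
        (by rwa [← Set.mem_preimage, hpre]) le_rfl,
      iteratedFDerivWithin_comp_add_left, hs, hL]
    have := hf.2 r le_rfl (fun _ => j) _ (update_mem_cube hx j ht)
    simpa [partialDeriv, L] using this

theorem IntervalClass.exists_taylor {r : ℕ} (hr : 1 ≤ r) {g : ℝ → ℝ} (hg : g ∈ IntervalClass r)
    {a b : ℝ} (ha : 0 ≤ a) (hab : a < b) (hb : b ≤ 1) :
    ∃ c : ℕ → ℝ, ∀ s ∈ Set.Icc a b,
      |g s - ∑ k ∈ Finset.range r, c k * (s - a) ^ k| ≤ (b - a) ^ r := by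
  obtain ⟨n, rfl⟩ : ∃ n, r = n + 1 := ⟨r - 1, by omega⟩
  have hsub : Set.Icc a b ⊆ Set.Icc 0 1 := Set.Icc_subset_Icc ha hb
  refine ⟨fun k => ((k.factorial : ℝ)⁻¹) * iteratedDerivWithin k g (Set.Icc a b) a,
    fun s hs => ?_⟩
  have h := taylor_mean_remainder_bound (C := 1) (n := n) hab.le
    (by exact_mod_cast hg.1.mono hsub) hs fun y hy => by
      have := hg.2 y (hsub hy)
      rwa [iteratedDerivWithin_eq_iteratedFDerivWithin, iteratedFDerivWithin_subset hsub
        (uniqueDiffOn_Icc hab) (uniqueDiffOn_Icc zero_lt_one) hg.1 hy]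
  rw [taylor_within_apply, Real.norm_eq_abs] at h
  refine le_trans (le_of_eq ?_) (h.trans ?_)
  · congr 2
    refine Finset.sum_congr rfl fun k _ => ?_
    simp only [smul_eq_mul]
    ring
  · rw [one_mul]
    have h0 : 0 ≤ s - a := by linarith [hs.1]
    refine (div_le_self (by positivity) (by exact_mod_cast n.factorial_pos)).trans ?_
    exact pow_le_pow_left₀ h0 (by linarith [hs.2]) _

/-! ### Univariate quadrature and interpolation -/

/-- By Carathéodory's theorem the hull is a continuous image of a compact set: a simplex times `dim
E + 1` copies of `s`. Shorter convex combinations are padded with weight zero. -/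
theorem isCompact_convexHull_of_isCompact {E : Type*} [NormedAddCommGroup E] [NormedSpace ℝ E]
    [FiniteDimensional ℝ E] {s : Set E} (hs : IsCompact s) : IsCompact (convexHull ℝ s) := by
  let ν := Fin (Module.finrank ℝ E + 1)
  have hK : IsCompact (stdSimplex ℝ ν ×ˢ Set.univ.pi fun _ : ν => s) :=
    (isCompact_stdSimplex ℝ ν).prod (isCompact_univ_pi fun _ => hs)
  have hc : Continuous fun p : (ν → ℝ) × (ν → E) => ∑ i, p.1 i • p.2 i := by fun_prop
  convert hK.image hc
  ext x
  constructor
  · intro hx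
    obtain ⟨ι, _, z, w, hz, hind, hw, hw1, rfl⟩ := eq_pos_convex_span_of_mem_convexHull hx
    have hcard : Fintype.card ι ≤ Fintype.card ν := by
      simpa [ν] using hind.card_le_finrank_succ.trans
        (Nat.succ_le_succ (Submodule.finrank_le _))
    obtain ⟨e⟩ := Function.Embedding.nonempty_of_card_le hcard
    have hne : Nonempty ι := by
      by_contra h
      rw [not_nonempty_iff] at h
      simp at hw1
    have hwe : ∀ i ∉ Set.range e, Function.extend e w 0 i = 0 := fun i hi =>
      Function.extend_apply' _ _ _ hi
    refine ⟨(Function.extend e w 0, Function.extend e z fun _ => z hne.some),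
      ⟨⟨fun i => ?_, ?_⟩, fun i _ => ?_⟩, ?_⟩
    · by_cases hi : i ∈ Set.range e
      · obtain ⟨j, rfl⟩ := hi
        simpa [e.injective.extend_apply] using (hw j).le
      · exact (hwe i hi).ge
    · rw [← hw1]
      exact (Fintype.sum_of_injective e e.injective _ _ hwe
        fun j => (e.injective.extend_apply _ _ _).symm).symm
    · by_cases hi : i ∈ Set.range e
      · obtain ⟨j, rfl⟩ := hi
        simpa [e.injective.extend_apply] using hz (Set.mem_range_self j)
      · simpa [Function.extend_apply' _ _ _ hi] using hz (Set.mem_range_self _)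
    · refine (Fintype.sum_of_injective e e.injective _ _ (fun i hi => ?_) fun j => ?_).symm
      · simp [hwe i hi]
      · simp [e.injective.extend_apply]
  · rintro ⟨⟨w, z⟩, ⟨hw, hz⟩, rfl⟩
    exact (convex_convexHull ℝ s).sum_mem (fun i _ => hw.1 i) hw.2
      fun i _ => subset_convexHull ℝ s (hz i trivial)

/-- The vector of moments of Lebesgue measure is the barycentre of the moment curve, hence lies in
its closed convex hull; a convex combination representing it is the rule. Nonnegative weights matter
more than economy in nodes, since they keep tensor products stable. -/
theorem exists_quadrature (r : ℕ) : ∃ (ι : Type) (_ : Fintype ι) (w t : ι → ℝ),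
    (∀ i, 0 ≤ w i) ∧ ∑ i, w i = 1 ∧ (∀ i, t i ∈ Set.Icc (0 : ℝ) 1) ∧
      ∀ k < r, ∑ i, w i * t i ^ k = 1 / (k + 1) := by
  let γ : ℝ → (Fin r → ℝ) := fun s k => s ^ (k : ℕ)
  have hγ : Continuous γ := by fun_prop
  have hcomp : IsCompact (γ '' Set.Icc 0 1) := isCompact_Icc.image hγ
  have hprob : IsProbabilityMeasure (volume.restrict (Set.Icc (0 : ℝ) 1)) := ⟨by simp⟩
  have hint : Integrable γ (volume.restrict (Set.Icc (0 : ℝ) 1)) :=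
    hγ.continuousOn.integrableOn_compact isCompact_Icc
  have hmem : (∫ s in Set.Icc (0 : ℝ) 1, γ s) ∈ convexHull ℝ (γ '' Set.Icc 0 1) :=
    (convex_convexHull ℝ _).integral_mem (isCompact_convexHull_of_isCompact hcomp).isClosed
      ((ae_restrict_mem measurableSet_Icc).mono fun s hs =>
        subset_convexHull ℝ _ (Set.mem_image_of_mem γ hs)) hint
  obtain ⟨ι, _, w, z, hw, hw1, hz, hsum⟩ := mem_convexHull_iff_exists_fintype.1 hmem
  choose t ht htz using hz
  refine ⟨ι, inferInstance, w, t, hw, hw1, ht, fun k hk => ?_⟩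
  have h := congrFun hsum ⟨k, hk⟩
  simp only [Finset.sum_apply, Pi.smul_apply, smul_eq_mul, ← htz] at h
  rw [eval_integral (fun i => hint.eval i)] at h
  refine h.trans ?_
  rw [integral_Icc_eq_integral_Ioc, ← intervalIntegral.integral_of_le zero_le_one]
  simp [γ]

/-- One panel of the composite quadrature rule. -/
theorem IntervalClass.abs_integral_sub_panel_le {r : ℕ} (hr : 1 ≤ r) {ι : Type} [Fintype ι]
    {w t : ι → ℝ} (hw : ∀ i, 0 ≤ w i) (hw1 : ∑ i, w i = 1) (ht : ∀ i, t i ∈ Set.Icc (0 : ℝ) 1)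
    (hex : ∀ k < r, ∑ i, w i * t i ^ k = 1 / (k + 1)) {g : ℝ → ℝ} (hg : g ∈ IntervalClass r)
    {a h : ℝ} (ha : 0 ≤ a) (hh : 0 < h) (hah : a + h ≤ 1) :
    |(∫ s in a..(a + h), g s) - h * ∑ i, w i * g (a + h * t i)| ≤ 2 * h * h ^ r := by
  obtain ⟨c, hc⟩ := IntervalClass.exists_taylor hr hg ha (by linarith : a < a + h) hah
  rw [add_sub_cancel_left] at hc
  set p : ℝ → ℝ := fun s => ∑ k ∈ Finset.range r, c k * (s - a) ^ k with hp
  have hpc : Continuous p := by fun_prop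
  have hgi : IntervalIntegrable g volume a (a + h) := by
    refine ContinuousOn.intervalIntegrable ?_
    rw [Set.uIcc_of_le (by linarith)]
    exact hg.1.continuousOn.mono (Set.Icc_subset_Icc ha hah)
  have hpi : ∫ s in a..(a + h), p s = h * ∑ i, w i * p (a + h * t i) := by
    have h1 : ∫ s in a..(a + h), p s = ∑ k ∈ Finset.range r, c k * (h ^ (k + 1) / (k + 1)) := by
      rw [intervalIntegral.integral_finsetSum fun k _ =>
        (Continuous.intervalIntegrable (by fun_prop) _ _)]
      refine Finset.sum_congr rfl fun k _ => ?_
      rw [intervalIntegral.integral_const_mul,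
        intervalIntegral.integral_comp_sub_right (fun s => s ^ k)]
      simp
    rw [h1]
    simp only [hp, add_sub_cancel_left, mul_pow, Finset.mul_sum]
    rw [Finset.sum_comm]
    refine Finset.sum_congr rfl fun k hk => ?_
    have : ∑ i, h * (w i * (c k * (h ^ k * t i ^ k))) =
        c k * h ^ (k + 1) * ∑ i, w i * t i ^ k := by
      rw [Finset.mul_sum]
      exact Finset.sum_congr rfl fun i _ => by ring
    rw [this, hex k (Finset.mem_range.1 hk)]
    ring
  have e1 : |∫ s in a..(a + h), (g s - p s)| ≤ h ^ r * |a + h - a| := by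
    rw [← Real.norm_eq_abs]
    refine intervalIntegral.norm_integral_le_of_norm_le_const fun s hs => ?_
    rw [Set.uIoc_of_le (by linarith)] at hs
    exact hc s (Set.Ioc_subset_Icc_self hs)
  rw [intervalIntegral.integral_sub hgi (hpc.intervalIntegrable _ _), hpi, add_sub_cancel_left,
    abs_of_pos hh] at e1
  -- Nonnegative weights of sum one average the nodal Taylor errors without amplifying them; `e1`
  -- and `e2` account for the factor `2`.
  have e2 : |∑ i, w i * (g (a + h * t i) - p (a + h * t i))| ≤ h ^ r := by
    calc _ ≤ ∑ i, w i * h ^ r := by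
          refine (Finset.abs_sum_le_sum_abs _ _).trans (Finset.sum_le_sum fun i _ => ?_)
          rw [abs_mul, abs_of_nonneg (hw i)]
          refine mul_le_mul_of_nonneg_left (hc _ ?_) (hw i)
          constructor <;> nlinarith [(ht i).1, (ht i).2]
      _ = h ^ r := by rw [← Finset.sum_mul, hw1, one_mul]
  have e3 : h * |∑ i, w i * (g (a + h * t i) - p (a + h * t i))| ≤ h * h ^ r :=
    mul_le_mul_of_nonneg_left e2 hh.le
  rw [← abs_of_pos hh, ← abs_mul, abs_of_pos hh] at e3
  simp only [mul_sub, Finset.sum_sub_distrib] at e3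
  calc _ = |((∫ s in a..(a + h), g s) - h * ∑ i, w i * p (a + h * t i)) -
        (h * ∑ i, w i * g (a + h * t i) - h * ∑ i, w i * p (a + h * t i))| := by ring_nf
    _ ≤ _ := (abs_sub _ _).trans (by linarith)

theorem IntervalClass.abs_integral_sub_composite_le {r : ℕ} (hr : 1 ≤ r) {ι : Type} [Fintype ι]
    {w t : ι → ℝ} (hw : ∀ i, 0 ≤ w i) (hw1 : ∑ i, w i = 1) (ht : ∀ i, t i ∈ Set.Icc (0 : ℝ) 1)
    (hex : ∀ k < r, ∑ i, w i * t i ^ k = 1 / (k + 1)) {g : ℝ → ℝ} (hg : g ∈ IntervalClass r)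
    {m : ℕ} (hm : 0 < m) :
    |(∫ s in Set.Icc (0 : ℝ) 1, g s) -
      ∑ p : Fin m × ι, (w p.2 / m) * g ((p.1 + t p.2) / m)| ≤ 2 * (1 / (m : ℝ)) ^ r := by
  have hm' : (0 : ℝ) < m := by exact_mod_cast hm
  set h : ℝ := 1 / m with hh
  have hpos : 0 < h := by positivity
  have hmh : (m : ℝ) * h = 1 := by rw [hh]; field_simp
  have hle : ∀ k < m, (k : ℝ) * h + h ≤ 1 := by
    intro k hk
    have : (k : ℝ) + 1 ≤ m := by exact_mod_cast hk
    nlinarith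
  have hint : ∀ k < m, IntervalIntegrable g volume ((k : ℕ) * h) ((k + 1 : ℕ) * h) := by
    intro k hk
    refine ContinuousOn.intervalIntegrable ?_
    push_cast
    rw [Set.uIcc_of_le (by linarith)]
    exact hg.1.continuousOn.mono (Set.Icc_subset_Icc (by positivity)
      (by linarith [hle k hk]))
  have hsplit := intervalIntegral.sum_integral_adjacent_intervals hint
  rw [hmh, Nat.cast_zero, zero_mul] at hsplit
  rw [integral_Icc_eq_integral_Ioc, ← intervalIntegral.integral_of_le zero_le_one, ← hsplit,
    ← Fin.sum_univ_eq_sum_range (fun k => ∫ s in ((k : ℕ) * h)..((k + 1 : ℕ) * h), g s),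
    Fintype.sum_prod_type, ← Finset.sum_sub_distrib]
  calc _ ≤ ∑ k : Fin m, 2 * h * h ^ r := by
        refine (Finset.abs_sum_le_sum_abs _ _).trans (Finset.sum_le_sum fun k _ => ?_)
        have := IntervalClass.abs_integral_sub_panel_le hr hw hw1 ht hex hg
          (a := k * h) (by positivity) hpos
          (hle k k.2)
        have e1 : ((k + 1 : ℕ) : ℝ) * h = k * h + h := by push_cast; ring
        have e2 : ∑ i, (w i / m) * g ((k + t i) / m) = h * ∑ i, w i * g (k * h + h * t i) := by
          rw [Finset.mul_sum]
          refine Finset.sum_congr rfl fun i _ => ?_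
          rw [show ((k : ℝ) + t i) / m = k * h + h * t i by rw [hh]; ring, hh]
          ring
        rw [e1]
        exact e2 ▸ this
    _ = 2 * h ^ r := by
        rw [Finset.sum_const, Finset.card_univ, Fintype.card_fin, nsmul_eq_mul]
        linear_combination 2 * h ^ r * hmh

/-- The hat functions of piecewise linear interpolation at the nodes `l / m`. -/
def hat (m l : ℕ) (t : ℝ) : ℝ := max 0 (1 - |m * t - l|)

theorem hat_nonneg (m l : ℕ) (t : ℝ) : 0 ≤ hat m l t := le_max_left _ _

@[fun_prop]
theorem continuous_hat (m l : ℕ) : Continuous (hat m l) := by unfold hat; fun_prop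

theorem exists_sum_hat_mul {m : ℕ} (hm : 0 < m) {t : ℝ} (ht : t ∈ Set.Icc (0 : ℝ) 1) :
    ∃ j < m, (j : ℝ) ≤ m * t ∧ m * t ≤ j + 1 ∧ ∀ G : ℕ → ℝ,
      ∑ l : Fin (m + 1), hat m l t * G l = (j + 1 - m * t) * G j + (m * t - j) * G (j + 1) := by
  have hm' : (0 : ℝ) < m := by exact_mod_cast hm
  have hmt : 0 ≤ (m : ℝ) * t := mul_nonneg hm'.le ht.1
  obtain ⟨j, hj, h1, h2⟩ : ∃ j < m, (j : ℝ) ≤ m * t ∧ m * t ≤ j + 1 := by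
    rcases ht.2.lt_or_eq with h | h
    · refine ⟨⌊(m : ℝ) * t⌋₊, (Nat.floor_lt hmt).2 (by nlinarith), Nat.floor_le hmt,
        (Nat.lt_floor_add_one _).le⟩
    -- At the right endpoint the floor would be `m`, one past the last subinterval.
    · refine ⟨m - 1, by omega, ?_, ?_⟩ <;> rw [h, Nat.cast_sub hm] <;> push_cast <;> linarith
  refine ⟨j, hj, h1, h2, fun G => ?_⟩
  rw [Fin.sum_univ_eq_sum_range (fun l => hat m l t * G l),
    Finset.sum_eq_add j (j + 1) (by omega)]
  · congr 2
    · rw [hat, abs_of_nonneg (by linarith), max_eq_right (by linarith)]; ring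
    · rw [hat, abs_of_nonpos (by push_cast; linarith), max_eq_right (by push_cast; linarith)]
      push_cast; ring
  · intro l _ hl
    have : hat m l t = 0 := by
      refine max_eq_left ?_
      rcases lt_or_gt_of_ne hl.1 with h | h
      · have : (l : ℝ) + 1 ≤ j := by exact_mod_cast h
        linarith [le_abs_self (m * t - l)]
      · have : (j : ℝ) + 1 + 1 ≤ l := by
          have h3 : j + 1 + 1 ≤ l := by omega
          exact_mod_cast h3
        linarith [neg_abs_le (m * t - l)]
    rw [this, zero_mul]
  · intro h; simp at h; omega
  · intro h; simp at h; omega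

theorem sum_hat {m : ℕ} (hm : 0 < m) {t : ℝ} (ht : t ∈ Set.Icc (0 : ℝ) 1) :
    ∑ l : Fin (m + 1), hat m l t = 1 := by
  obtain ⟨j, -, -, -, h⟩ := exists_sum_hat_mul hm ht
  have := h fun _ => 1
  simp only [mul_one] at this
  rw [this]
  ring

theorem IntervalClass.abs_sub_sum_hat_le {r : ℕ} (hr : 1 ≤ r) (hr2 : r ≤ 2) {g : ℝ → ℝ}
    (hg : g ∈ IntervalClass r) {m : ℕ} (hm : 0 < m) {t : ℝ} (ht : t ∈ Set.Icc (0 : ℝ) 1) :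
    |g t - ∑ l : Fin (m + 1), hat m l t * g (l / m)| ≤ 2 * (1 / (m : ℝ)) ^ r := by
  obtain ⟨j, hj, h1, h2, h⟩ := exists_sum_hat_mul hm ht
  have hm' : (0 : ℝ) < m := by exact_mod_cast hm
  have hj1 : (j : ℝ) + 1 ≤ m := by exact_mod_cast hj
  have hab : (j : ℝ) / m < (j + 1) / m := by gcongr; linarith
  obtain ⟨c, hc⟩ := IntervalClass.exists_taylor hr hg (a := j / m) (b := (j + 1) / m)
    (by positivity) hab
    ((div_le_one hm').2 hj1)
  rw [show ((j : ℝ) + 1) / m - j / m = 1 / m by ring] at hc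
  rw [h fun l => g (l / m)]
  have ct := hc t ⟨by rw [div_le_iff₀ hm']; linarith, by rw [le_div_iff₀ hm']; linarith⟩
  have ca := hc (j / m) ⟨le_rfl, hab.le⟩
  have cb := hc ((j + 1) / m) ⟨hab.le, le_rfl⟩
  set P : ℝ → ℝ := fun s => ∑ k ∈ Finset.range r, c k * (s - j / m) ^ k with hP
  -- This is where `r ≤ 2` enters: the Taylor polynomial is affine and therefore reproduced by
  -- linear interpolation.
  have hlin : P t = (j + 1 - m * t) * P (j / m) + (m * t - j) * P ((j + 1) / m) := by
    simp only [hP]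
    have : r = 1 ∨ r = 2 := by omega
    rcases this with rfl | rfl
    · simp; ring
    · simp [Finset.sum_range_succ]; field_simp; ring
  have hw1 : 0 ≤ j + 1 - m * t := by linarith
  have hw2 : 0 ≤ m * t - j := by linarith
  push_cast
  rw [abs_le] at ct ca cb ⊢
  change _ ≤ g t - P t ∧ g t - P t ≤ _ at ct
  change _ ≤ g _ - P _ ∧ g _ - P _ ≤ _ at ca
  change _ ≤ g _ - P _ ∧ g _ - P _ ≤ _ at cb
  constructor
  · nlinarith [mul_le_mul_of_nonneg_left ca.2 hw1, mul_le_mul_of_nonneg_left cb.2 hw2]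
  · nlinarith [mul_le_mul_of_nonneg_left ca.1 hw1, mul_le_mul_of_nonneg_left cb.1 hw2]

/-! ### Tensor products of univariate algorithms -/

/-- The value of the tensor product of the univariate rules with nodes `t i` and weights `a j i`. -/
def tensorRule {d : ℕ} {ι : Type*} [Fintype ι] (a : Fin d → ι → ℝ)
    (y : (Fin d → ι) → ℝ) : ℝ := ∑ κ : Fin d → ι, (∏ j, a j (κ j)) * y κ

theorem tensorRule_succ {d : ℕ} {ι : Type*} [Fintype ι] (a : Fin (d + 1) → ι → ℝ)
    (y : (Fin (d + 1) → ι) → ℝ) : tensorRule a y =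
      tensorRule (fun j => a j.succ) fun κ => ∑ i, a 0 i * y (Fin.cons i κ) := by
  unfold tensorRule
  rw [← (Fin.consEquiv fun _ => ι).sum_comp, Fintype.sum_prod_type, Finset.sum_comm]
  refine Finset.sum_congr rfl fun κ _ => ?_
  rw [Finset.mul_sum]
  refine Finset.sum_congr rfl fun i _ => ?_
  simp only [Fin.consEquiv, Equiv.coe_fn_mk, Fin.prod_univ_succ, Fin.cons_zero, Fin.cons_succ]
  ring

theorem tensorRule_sub {d : ℕ} {ι : Type*} [Fintype ι] (a : Fin d → ι → ℝ)
    (y z : (Fin d → ι) → ℝ) :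
    tensorRule a y - tensorRule a z = tensorRule a fun κ => y κ - z κ := by
  simp [tensorRule, mul_sub, Finset.sum_sub_distrib]

theorem sum_prod_weights {d : ℕ} {ι : Type*} [Fintype ι] {a : Fin d → ι → ℝ}
    (ha1 : ∀ j, ∑ i, a j i = 1) : ∑ κ : Fin d → ι, ∏ j, a j (κ j) = 1 := by
  classical
  rw [← Fintype.piFinset_univ, ← Finset.prod_univ_sum]
  simp [ha1]

/-- The product weights are again nonnegative with sum one, so the stability constant is one in
every dimension. -/
theorem abs_tensorRule_le {d : ℕ} {ι : Type*} [Fintype ι] {a : Fin d → ι → ℝ}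
    (ha : ∀ j i, 0 ≤ a j i) (ha1 : ∀ j, ∑ i, a j i = 1) {y : (Fin d → ι) → ℝ} {E : ℝ}
    (hy : ∀ κ, |y κ| ≤ E) : |tensorRule a y| ≤ E := by
  calc |tensorRule a y| ≤ ∑ κ : Fin d → ι, (∏ j, a j (κ j)) * E := by
        refine (Finset.abs_sum_le_sum_abs _ _).trans (Finset.sum_le_sum fun κ _ => ?_)
        have h0 : 0 ≤ ∏ j, a j (κ j) := Finset.prod_nonneg fun j _ => ha j _
        rw [abs_mul, abs_of_nonneg h0]
        exact mul_le_mul_of_nonneg_left (hy κ) h0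
    _ = E := by rw [← Finset.sum_mul, sum_prod_weights ha1, one_mul]

theorem integrable_of_continuous_of_abs_le {α : Type*} [TopologicalSpace α] [MeasurableSpace α]
    [OpensMeasurableSpace α] {μ : Measure α} [IsFiniteMeasure μ] {F : α → ℝ} {B : ℝ}
    (hF : Continuous F) (hB : ∀ x, |F x| ≤ B) : Integrable F μ :=
  Integrable.of_bound hF.measurable.aestronglyMeasurable B (Filter.Eventually.of_forall hB)

/-- Replace integration by the rule one coordinate at a time; each replacement costs `E` because the
other coordinates are only averaged. The factor measures are arbitrary so that both Lebesgue and
Dirac measures are covered. -/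
theorem abs_integral_pi_sub_tensorRule_le {ι : Type*} [Fintype ι] (t : ι → ℝ) {B E : ℝ} :
    ∀ {d : ℕ} {a : Fin d → ι → ℝ} (μ : Fin d → Measure ℝ) [∀ j, IsProbabilityMeasure (μ j)],
    (∀ j i, 0 ≤ a j i) → (∀ j, ∑ i, a j i = 1) → ∀ {F : (Fin d → ℝ) → ℝ}, Continuous F →
    (∀ x, |F x| ≤ B) →
    (∀ j x, |(∫ s, F (Function.update x j s) ∂(μ j)) -
      ∑ i, a j i * F (Function.update x j (t i))| ≤ E) →
    |(∫ x, F x ∂(Measure.pi μ)) - tensorRule a fun κ => F fun j => t (κ j)| ≤ d * E := by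
  intro d
  induction d with
  | zero =>
    intro a μ _ _ _ F _ _ _
    rw [Measure.pi_of_empty, integral_dirac]
    have : ∀ κ : Fin 0 → ι, F (fun j => t (κ j)) = F isEmptyElim := fun κ =>
      congrArg F (Subsingleton.elim _ _)
    simp [tensorRule, this]
  | succ d ih =>
    intro a μ _ ha ha1 F hF hB hE
    have hcons : Continuous fun p : ℝ × (Fin d → ℝ) => (Fin.cons p.1 p.2 : Fin (d + 1) → ℝ) := by
      refine continuous_pi fun j => ?_
      refine Fin.cases ?_ (fun j => ?_) j
      · simpa using continuous_fst
      · simp only [Fin.cons_succ]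
        exact (continuous_apply j).comp continuous_snd
    have hupd0 : ∀ (s u : ℝ) (y : Fin d → ℝ), Function.update (Fin.cons u y : Fin (d + 1) → ℝ) 0 s
        = Fin.cons s y := fun s u y => Fin.update_cons_zero _ _ _
    have hFc : Continuous fun p : ℝ × (Fin d → ℝ) => F (Fin.cons p.1 p.2) := hF.comp hcons
    let ν : Measure (Fin d → ℝ) := Measure.pi fun j => μ j.succ
    have hsplit : ∫ x, F x ∂(Measure.pi μ) = ∫ s, ∫ y, F (Fin.cons s y) ∂ν ∂(μ 0) := by
      rw [← ((measurePreserving_piFinSuccAbove μ 0).symm).integral_comp']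
      have hint : Integrable (fun p : ℝ × (Fin d → ℝ) => F (Fin.cons p.1 p.2)) ((μ 0).prod ν) :=
        integrable_of_continuous_of_abs_le hFc fun p => hB _
      rw [← integral_prod _ hint]
      simp only [ν, Fin.succAbove_zero, MeasurableEquiv.piFinSuccAbove, Fin.insertNthEquiv_zero]
      rfl
    -- Intermediate stage: the rule is applied in all coordinates but the first, which is still to
    -- be integrated.
    let Q : ℝ → ℝ := fun s => tensorRule (fun j => a j.succ) fun κ => F (Fin.cons s fun j => t (κ j))
    have hQc : Continuous Q := by
      refine continuous_finsetSum _ fun κ _ => continuous_const.mul ?_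
      exact hFc.comp (continuous_id.prodMk continuous_const)
    have hQB : ∀ s, |Q s| ≤ B := fun s =>
      abs_tensorRule_le (a := fun j => a j.succ) (fun j i => ha j.succ i) (fun j => ha1 j.succ)
        fun κ => hB _
    have h1 : ∀ s, |(∫ y, F (Fin.cons s y) ∂ν) - Q s| ≤ d * E := by
      intro s
      refine ih (a := fun j => a j.succ) (fun j => μ j.succ) (fun j i => ha j.succ i)
        (fun j => ha1 j.succ) (hFc.comp (continuous_const.prodMk continuous_id))
        (fun x => hB _) fun j x => ?_
      have := hE j.succ (Fin.cons s x)
      simpa only [Fin.cons_update] using this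
    have hinner : Integrable (fun s => ∫ y, F (Fin.cons s y) ∂ν) (μ 0) :=
      (integrable_of_continuous_of_abs_le (μ := (μ 0).prod ν) hFc
        fun p => hB _).integral_prod_left
    have hQi : Integrable Q (μ 0) := integrable_of_continuous_of_abs_le hQc hQB
    have h2 : |(∫ s, ∫ y, F (Fin.cons s y) ∂ν ∂(μ 0)) - ∫ s, Q s ∂(μ 0)| ≤ d * E := by
      rw [← integral_sub hinner hQi, ← Real.norm_eq_abs]
      refine (norm_integral_le_of_norm_le_const (Filter.Eventually.of_forall h1)).trans ?_
      simp
    have h3 : ∫ s, Q s ∂(μ 0) = tensorRule (fun j => a j.succ)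
        fun κ => ∫ s, F (Fin.cons s fun j => t (κ j)) ∂(μ 0) := by
      simp only [Q, tensorRule]
      rw [integral_finsetSum]
      · exact Finset.sum_congr rfl fun κ _ => integral_const_mul _ _
      · intro κ _
        exact (integrable_of_continuous_of_abs_le
          (hFc.comp (continuous_id.prodMk continuous_const)) fun s => hB _).const_mul _
    have h4 : |(∫ s, Q s ∂(μ 0)) - tensorRule a fun κ => F fun j => t (κ j)| ≤ E := by
      rw [h3, tensorRule_succ, tensorRule_sub]
      refine abs_tensorRule_le (a := fun j => a j.succ) (fun j i => ha j.succ i)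
        (fun j => ha1 j.succ) fun κ => ?_
      have := hE 0 (Fin.cons 0 fun j => t (κ j))
      simp only [hupd0] at this
      convert this using 6 with i
      ext j
      refine Fin.cases ?_ (fun j => ?_) j <;> simp
    rw [hsplit]
    calc _ ≤ _ := abs_sub_le _ (∫ s, Q s ∂(μ 0)) _
      _ ≤ d * E + E := add_le_add h2 h4
      _ = _ := by push_cast; ring

/-- The nearest point of the unit cube. -/
def clamp {d : ℕ} (x : Fin d → ℝ) : Fin d → ℝ := fun j => max 0 (min 1 (x j))

theorem clamp_mem_cube {d : ℕ} (x : Fin d → ℝ) : clamp x ∈ cube d :=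
  mem_cube.2 fun _ => ⟨le_max_left _ _, max_le zero_le_one (min_le_left _ _)⟩

theorem clamp_of_mem {d : ℕ} {x : Fin d → ℝ} (hx : x ∈ cube d) : clamp x = x := by
  funext j
  have := mem_cube.1 hx j
  simp [clamp, this.1, this.2]

theorem continuous_clamp {d : ℕ} : Continuous (clamp (d := d)) := by
  unfold clamp; fun_prop

theorem clamp_update {d : ℕ} (x : Fin d → ℝ) (j : Fin d) {s : ℝ} (hs : s ∈ Set.Icc (0 : ℝ) 1) :
    clamp (Function.update x j s) = Function.update (clamp x) j s := by
  funext i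
  rcases eq_or_ne i j with rfl | h
  · simp [clamp, hs.1, hs.2]
  · simp [clamp, h]

/-- Univariate errors add up in the tensor product. -/
theorem abs_integral_clamp_sub_tensorRule_le {r d : ℕ} {ι : Type*} [Fintype ι] {t : ι → ℝ} {E : ℝ}
    (ht : ∀ i, t i ∈ Set.Icc (0 : ℝ) 1) {a : Fin d → ι → ℝ} (μ : Fin d → Measure ℝ)
    [∀ j, IsProbabilityMeasure (μ j)] (hμ : ∀ j, ∀ᵐ s ∂(μ j), s ∈ Set.Icc (0 : ℝ) 1)
    (ha : ∀ j i, 0 ≤ a j i) (ha1 : ∀ j, ∑ i, a j i = 1)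
    (hE : ∀ j, ∀ g ∈ IntervalClass r, |(∫ s, g s ∂(μ j)) - ∑ i, a j i * g (t i)| ≤ E)
    {f : (Fin d → ℝ) → ℝ} (hf : f ∈ smoothClass r d) :
    |(∫ x, f (clamp x) ∂(Measure.pi μ)) - tensorRule a fun κ => f fun j => t (κ j)| ≤ d * E := by
  -- Clamping provides the globally continuous and bounded function that the product lemma asks for.
  have hc : Continuous fun x => f (clamp x) :=
    hf.1.continuousOn.comp_continuous continuous_clamp clamp_mem_cube
  obtain ⟨B, hB⟩ := (isCompact_cube d).exists_bound_of_continuousOn hf.1.continuousOn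
  have h := abs_integral_pi_sub_tensorRule_le t (E := E) μ ha ha1 hc
    (fun x => hB _ (clamp_mem_cube x)) fun j x => ?_
  · have hcl : ∀ κ : Fin d → ι, clamp (fun j => t (κ j)) = fun j => t (κ j) := fun κ =>
      clamp_of_mem (mem_cube.2 fun j => ht _)
    simpa only [hcl] using h
  · have := hE j _ (update_mem_intervalClass hf (clamp_mem_cube x) j)
    rw [integral_congr_ae ((hμ j).mono fun s hs => congrArg f (clamp_update x j hs))]
    simpa only [clamp_update x j (ht _)] using this

theorem volume_restrict_cube (d : ℕ) : (volume.restrict (cube d) : Measure (Fin d → ℝ)) =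
    Measure.pi fun _ => volume.restrict (Set.Icc (0 : ℝ) 1) := by
  rw [cube_eq_pi, volume_pi, Measure.restrict_pi_pi]

theorem dirac_eq_pi {d : ℕ} (z : Fin d → ℝ) :
    Measure.dirac z = Measure.pi fun j => Measure.dirac (z j) := by
  refine (Measure.pi_eq fun s hs => ?_).symm
  rw [Measure.dirac_apply' _ (MeasurableSet.univ_pi hs)]
  simp only [Measure.dirac_apply' _ (hs _)]
  classical
  simp [Set.indicator_apply, Finset.prod_boole]

theorem minIntError_smoothClass_le {r : ℕ} (hr : 1 ≤ r) : ∃ q : ℕ, 1 ≤ q ∧ ∀ d m : ℕ, 0 < m →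
    minIntError ((m * q) ^ d) (smoothClass r d) ≤
      ENNReal.ofReal (d * (2 * (1 / (m : ℝ)) ^ r)) := by
  obtain ⟨ι, _, w, t, hw, hw1, ht, hex⟩ := exists_quadrature r
  refine ⟨Fintype.card ι, ?_, fun d m hm => ?_⟩
  · rw [Nat.one_le_iff_ne_zero]
    intro h
    have : IsEmpty ι := Fintype.card_eq_zero_iff.1 h
    simp at hw1
  have hm' : (0 : ℝ) < m := by exact_mod_cast hm
  let τ : Fin m × ι → ℝ := fun p => (p.1 + t p.2) / m
  have hτ : ∀ p, τ p ∈ Set.Icc (0 : ℝ) 1 := by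
    intro p
    have h1 : ((p.1 : ℕ) : ℝ) + 1 ≤ m := by exact_mod_cast p.1.2
    refine ⟨div_nonneg (add_nonneg (by positivity) (ht _).1) hm'.le, ?_⟩
    rw [div_le_one hm']
    linarith [(ht p.2).2]
  have hcard : Fintype.card (Fin d → Fin m × ι) = (m * Fintype.card ι) ^ d := by simp
  rw [← hcard]
  have hprob : IsProbabilityMeasure (volume.restrict (Set.Icc (0 : ℝ) 1)) := ⟨by simp⟩
  refine minIntError_le (fun κ j => τ (κ j)) (fun κ => mem_cube.2 fun j => hτ _)
    (tensorRule fun _ p => w p.2 / m) fun f hf => ?_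
  have h := abs_integral_clamp_sub_tensorRule_le (E := 2 * (1 / (m : ℝ)) ^ r) hτ
    (a := fun (_ : Fin d) p => w p.2 / m) (fun _ => volume.restrict (Set.Icc (0 : ℝ) 1))
    (fun _ => ae_restrict_mem measurableSet_Icc) (fun _ p => div_nonneg (hw _) hm'.le)
    (fun _ => ?_)
    (fun _ g hg => IntervalClass.abs_integral_sub_composite_le hr hw hw1 ht hex hg hm) hf
  · rw [← volume_restrict_cube, setIntegral_congr_fun (measurableSet_cube d)
      fun x hx => congrArg f (clamp_of_mem hx)] at h
    rwa [abs_sub_comm]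
  · rw [Fintype.sum_prod_type]
    simp only [← Finset.sum_div, hw1]
    simp [hm'.ne']

theorem minAppError_smoothClass_le {r : ℕ} (hr : 1 ≤ r) (hr2 : r ≤ 2) (d : ℕ) {m : ℕ}
    (hm : 0 < m) : minAppError ((m + 1) ^ d) (smoothClass r d) ≤
      ENNReal.ofReal (d * (2 * (1 / (m : ℝ)) ^ r)) := by
  have hm' : (0 : ℝ) < m := by exact_mod_cast hm
  let τ : Fin (m + 1) → ℝ := fun l => (l : ℕ) / m
  have hτ : ∀ l, τ l ∈ Set.Icc (0 : ℝ) 1 := fun l =>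
    ⟨by positivity, (div_le_one hm').2 (by exact_mod_cast l.is_le)⟩
  have hcard : Fintype.card (Fin d → Fin (m + 1)) = (m + 1) ^ d := by simp
  rw [← hcard]
  refine minAppError_le (fun κ j => τ (κ j)) (fun κ => mem_cube.2 fun j => hτ _)
    (fun y z => tensorRule (fun j (l : Fin (m + 1)) => hat m l (z j)) y)
    (fun y => ?_) fun f hf z hz => ?_
  · have hcont : Continuous fun z : Fin d → ℝ => tensorRule (fun j (l : Fin (m + 1)) =>
        hat m l (z j)) y := by
      unfold tensorRule
      fun_prop
    obtain ⟨B, hB⟩ := (isCompact_cube d).exists_bound_of_continuousOn hcont.continuousOn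
    exact memLp_top_of_bound hcont.measurable.aestronglyMeasurable B
      ((ae_restrict_mem (measurableSet_cube d)).mono hB)
  · have hz' := mem_cube.1 hz
    have h := abs_integral_clamp_sub_tensorRule_le (E := 2 * (1 / (m : ℝ)) ^ r) hτ
      (a := fun j l => hat m l (z j)) (fun j => Measure.dirac (z j))
      (fun j => (ae_dirac_iff measurableSet_Icc).2 (hz' j)) (fun _ _ => hat_nonneg _ _ _)
      (fun j => sum_hat hm (hz' j))
      (fun j g hg => by
        rw [integral_dirac]
        exact IntervalClass.abs_sub_sum_hat_le hr hr2 hg hm (hz' j)) hf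
    rwa [← dirac_eq_pi, integral_dirac, clamp_of_mem hz] at h

/-! ### Volumes of balls -/

/-- Exponential Markov inequality: the integral of `exp (-∑ ψ (x j))` factorises over the
coordinates. -/
theorem volume_sum_le_le {d : ℕ} {ψ : ℝ → ℝ} (hψ : Integrable fun t => Real.exp (-ψ t)) (R : ℝ) :
    volume {x : Fin d → ℝ | ∑ j, ψ (x j) ≤ R} ≤
      ENNReal.ofReal (Real.exp R * (∫ t, Real.exp (-ψ t)) ^ d) := by
  set F : (Fin d → ℝ) → ℝ := fun x => ∏ j, Real.exp (-ψ (x j)) with hF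
  have hFi : Integrable F := Integrable.fintype_prod fun _ => hψ
  have hFint : ∫ x, F x = (∫ t, Real.exp (-ψ t)) ^ d := by
    rw [hF, integral_fintype_prod_volume_eq_pow fun t => Real.exp (-ψ t), Fintype.card_fin]
  have hset : {x : Fin d → ℝ | ∑ j, ψ (x j) ≤ R} = {x | Real.exp (-R) ≤ F x} := by
    ext x
    simp [hF, ← Real.exp_sum, Real.exp_le_exp, Finset.sum_neg_distrib]
  have hM := mul_meas_ge_le_integral_of_nonneg (μ := volume)
    (Filter.Eventually.of_forall fun x => Finset.prod_nonneg fun j _ => (Real.exp_pos (-ψ (x j))).le)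
    hFi (Real.exp (-R))
  rw [hset, ← ofReal_measureReal (hFi.measure_ge_lt_top (Real.exp_pos _)).ne]
  refine ENNReal.ofReal_le_ofReal ?_
  rw [← hFint]
  calc _ = Real.exp R * (Real.exp (-R) * volume.real {x | Real.exp (-R) ≤ F x}) := by
        rw [← mul_assoc, ← Real.exp_add, add_neg_cancel, Real.exp_zero, one_mul]
    _ ≤ _ := mul_le_mul_of_nonneg_left hM (Real.exp_pos R).le

/-- Scaling `ψ` so that the ball becomes `∑ ψ (x j) ≤ d` yields `exp d` times the `d`th power of a
one-dimensional integral, with the right decay in `d`. The Euclidean case is the same with a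
Gaussian. -/
theorem volume_sum_abs_le_le {d : ℕ} (hd : 1 ≤ d) {ρ : ℝ} (hρ : 0 < ρ) :
    volume {x : Fin d → ℝ | ∑ j, |x j| ≤ ρ} ≤
      ENNReal.ofReal ((2 * Real.exp 1 * (ρ / d)) ^ d) := by
  have hd' : (0 : ℝ) < d := by exact_mod_cast hd
  have hs : 0 < ρ / d := by positivity
  have hint : ∫ t : ℝ, Real.exp (-(|t| / (ρ / d))) = 2 * (ρ / d) := by
    rw [integral_comp_abs (f := fun t => Real.exp (-(t / (ρ / d))))]
    have := integral_exp_neg_mul_rpow (p := 1) one_pos (inv_pos.2 hs)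
    simp only [Real.rpow_one, div_one, one_add_one_eq_two, Real.Gamma_two, mul_one,
      Real.rpow_neg_one, inv_inv] at this
    simp only [neg_mul, inv_mul_eq_div] at this
    rw [this]
  have hi : Integrable fun t : ℝ => Real.exp (-(|t| / (ρ / d))) :=
    Integrable.of_integral_ne_zero (by rw [hint]; positivity)
  have h := volume_sum_le_le (d := d) hi d
  rw [hint] at h
  refine le_trans (measure_mono fun x hx => ?_) (h.trans (ENNReal.ofReal_le_ofReal (le_of_eq ?_)))
  · simp only [Set.mem_ofPred_eq] at hx ⊢
    rw [← Finset.sum_div, div_le_iff₀ hs]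
    field_simp
    exact hx
  · rw [← Real.exp_one_pow, ← mul_pow]
    ring_nf

theorem volume_sum_sq_le_le {d : ℕ} (hd : 1 ≤ d) {ρ : ℝ} (hρ : 0 < ρ) :
    volume {x : Fin d → ℝ | ∑ j, x j ^ 2 ≤ ρ ^ 2} ≤
      ENNReal.ofReal ((Real.exp 1 * √Real.pi * (ρ / √d)) ^ d) := by
  have hd' : (0 : ℝ) < d := by exact_mod_cast hd
  have hb : 0 < d / ρ ^ 2 := by positivity
  have hi := integrable_exp_neg_mul_sq hb
  have hint := integral_gaussian (d / ρ ^ 2)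
  simp only [neg_mul] at hi hint
  have h := volume_sum_le_le (d := d) hi d
  rw [hint] at h
  refine le_trans (measure_mono fun x hx => ?_) (h.trans (ENNReal.ofReal_le_ofReal (le_of_eq ?_)))
  · simp only [Set.mem_ofPred_eq] at hx ⊢
    rw [← Finset.mul_sum]
    calc (d : ℝ) / ρ ^ 2 * ∑ j, x j ^ 2 ≤ d / ρ ^ 2 * ρ ^ 2 := by gcongr
      _ = (d : ℝ) := by field_simp
  · rw [← Real.exp_one_pow, ← mul_pow]
    congr 1
    rw [div_div_eq_mul_div, Real.sqrt_div (by positivity), Real.sqrt_mul Real.pi_nonneg,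
      Real.sqrt_sq hρ.le]
    ring

theorem volume_exists_sum_sub_le_le {d m : ℕ} {ψ : ℝ → ℝ} {R : ℝ} {v : ℝ≥0∞}
    (hv : volume {x : Fin d → ℝ | ∑ j, ψ (x j) ≤ R} ≤ v) (p : Fin m → Fin d → ℝ) :
    volume {x : Fin d → ℝ | ∃ i, ∑ j, ψ (x j - p i j) ≤ R} ≤ m * v := by
  have : {x : Fin d → ℝ | ∃ i, ∑ j, ψ (x j - p i j) ≤ R} =
      ⋃ i, (fun x => x - p i) ⁻¹' {x : Fin d → ℝ | ∑ j, ψ (x j) ≤ R} := by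
    ext x; simp
  rw [this]
  refine (measure_iUnion_fintype_le _ _).trans ?_
  calc _ ≤ ∑ _i : Fin m, v := Finset.sum_le_sum fun i _ => by
        simpa only [sub_eq_add_neg, measure_preimage_add_right] using hv
    _ = m * v := by simp

/-! ### Membership in the smoothness class -/

theorem mem_smoothClass_of_contDiff {r d : ℕ} {f : (Fin d → ℝ) → ℝ} (hf : ContDiff ℝ r f)
    (h : ∀ k ≤ r, ∀ (i : Fin k → Fin d) (x : Fin d → ℝ),
      |iteratedFDeriv ℝ k f x fun j => Pi.single (i j) 1| ≤ 1) : f ∈ smoothClass r d := by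
  refine ⟨hf.contDiffOn, fun k hk i x hx => ?_⟩
  rw [partialDeriv, iteratedFDerivWithin_eq_iteratedFDeriv (uniqueDiffOn_cube d)
    (hf.of_le (by exact_mod_cast hk)).contDiffAt hx]
  exact h k hk i x

theorem neg_mem_smoothClass {r d : ℕ} {f : (Fin d → ℝ) → ℝ} (hf : f ∈ smoothClass r d) :
    (fun x => -f x) ∈ smoothClass r d := by
  refine ⟨hf.1.neg, fun k hk i x hx => ?_⟩
  have : iteratedFDerivWithin ℝ k (fun x => -f x) (cube d) x =
      -iteratedFDerivWithin ℝ k f (cube d) x :=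
    iteratedFDerivWithin_neg_apply (uniqueDiffOn_cube d) hx
  rw [partialDeriv, this, neg_apply, abs_neg]
  exact hf.2 k hk i x hx

/-! ### Mollification -/

/-- A smooth probability density on `[-η, η]` together with its derivatives. -/
theorem exists_kernel (r : ℕ) : ∃ M : ℝ, 1 ≤ M ∧ ∀ η : ℝ, 0 < η → ∃ κ : ℕ → ℝ → ℝ,
    (∀ m, ContDiff ℝ (⊤ : ℕ∞) (κ m)) ∧ (∀ m t, HasDerivAt (κ m) (κ (m + 1) t) t) ∧
    (∀ m t, η < |t| → κ m t = 0) ∧ (∀ t, 0 ≤ κ 0 t) ∧ ∫ t, κ 0 t = 1 ∧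
    ∀ m ≤ r, ∫ t, |κ m t| ≤ (M / η) ^ m := by
  let B : ContDiffBump (0 : ℝ) := ⟨1 / 2, 1, by norm_num, by norm_num⟩
  let b : ℝ → ℝ := B.normed volume
  have hb : ContDiff ℝ (⊤ : ℕ∞) b := B.contDiff_normed
  have hbm : ∀ m, ContDiff ℝ (⊤ : ℕ∞) (iteratedDeriv m b) := fun m => by
    rw [iteratedDeriv_eq_iterate]
    exact hb.iterate_deriv m
  have hsupp : ∀ m t, 1 < |t| → iteratedDeriv m b t = 0 := by
    intro m t ht
    rw [iteratedDeriv_eq_iteratedFDeriv]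
    have : t ∉ tsupport (iteratedFDeriv ℝ m b) := by
      intro h
      have := tsupport_iteratedFDeriv_subset m h
      rw [B.tsupport_normed_eq] at this
      simp [Real.norm_eq_abs, B] at this
      linarith
    rw [image_eq_zero_of_notMem_tsupport this]
    rfl
  have h0 : ∀ m, 0 ≤ ∫ t, |iteratedDeriv m b t| := fun m => integral_nonneg fun t => abs_nonneg _
  let M := 1 + ∑ m ∈ Finset.range (r + 1), ∫ t, |iteratedDeriv m b t|
  have hM1 : 1 ≤ M := le_add_of_nonneg_right (Finset.sum_nonneg fun m _ => h0 m)
  have hM : ∀ m ≤ r, ∫ t, |iteratedDeriv m b t| ≤ M := fun m hm =>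
    (Finset.single_le_sum (f := fun m => ∫ t, |iteratedDeriv m b t|) (fun m _ => h0 m)
      (Finset.mem_range.2 (Nat.lt_succ_of_le hm))).trans (le_add_of_nonneg_left zero_le_one)
  have hb0 : iteratedDeriv 0 b = b := iteratedDeriv_zero
  refine ⟨M, hM1, fun η hη => ⟨fun m t => (η⁻¹) ^ (m + 1) * iteratedDeriv m b (t / η),
    fun m => ?_, fun m t => ?_, fun m t ht => ?_, fun t => ?_, ?_, fun m hm => ?_⟩⟩
  · exact contDiff_const.mul ((hbm m).comp (contDiff_id.div_const η))
  · have h1 : HasDerivAt (iteratedDeriv m b) (iteratedDeriv (m + 1) b (t / η)) (t / η) := by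
      rw [iteratedDeriv_succ]
      exact ((hbm m).differentiable (by simp) _).hasDerivAt
    have h2 := (h1.comp t ((hasDerivAt_id t).div_const η)).const_mul ((η⁻¹) ^ (m + 1))
    refine h2.congr_deriv ?_
    beta_reduce
    rw [pow_succ _ (m + 1)]
    ring
  · beta_reduce
    rw [hsupp, mul_zero]
    rwa [abs_div, abs_of_pos hη, one_lt_div hη]
  · beta_reduce
    rw [hb0]
    exact mul_nonneg (by positivity) (B.nonneg_normed _)
  · rw [integral_const_mul, Measure.integral_comp_div (fun t => iteratedDeriv 0 b t), hb0,
      B.integral_normed, abs_of_pos hη]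
    simp [hη.ne']
  · simp only [abs_mul, abs_of_pos (pow_pos (inv_pos.2 hη) _)]
    rw [integral_const_mul, Measure.integral_comp_div (fun t => |iteratedDeriv m b t|),
      abs_of_pos hη, smul_eq_mul]
    -- For `m = 0` there is no room for a constant, and the normalisation of `b` gives the bound
    -- one; for `m ≥ 1` the inequality `M ≤ M ^ m` suffices.
    have h1 : ∫ t, |iteratedDeriv m b t| ≤ M ^ m := by
      rcases Nat.eq_zero_or_pos m with rfl | hpos
      · rw [hb0, pow_zero]
        simp only [abs_of_nonneg (B.nonneg_normed (μ := volume) _), b]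
        exact B.integral_normed.le
      · exact (hM m hm).trans (le_self_pow₀ hM1 hpos.ne')
    calc _ = (η⁻¹) ^ m * ∫ t, |iteratedDeriv m b t| := by
          rw [pow_succ]; field_simp
      _ ≤ (η⁻¹) ^ m * M ^ m := by gcongr
      _ = _ := by rw [← mul_pow]; ring

/-- Lipschitz functions that vanish near given points and are constant far away from them. -/
theorem exists_ramp {d m : ℕ} (p : Fin m → Fin d → ℝ) {a L T : ℝ} (hL : 0 < L) (hT : 0 ≤ T) :
    ∃ g : (Fin d → ℝ) → ℝ, Continuous g ∧ (∀ x, 0 ≤ g x) ∧ (∀ x, g x ≤ T) ∧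
      (∀ x y, |g x - g y| ≤ L * ∑ j, |x j - y j|) ∧
      (∀ i x, ∑ j, |x j - p i j| ≤ a → g x = 0) ∧
      ∀ x, (∀ i, a + T / L ≤ ∑ j, |x j - p i j|) → g x = T := by
  induction m with
  | zero =>
    refine ⟨fun _ => T, continuous_const, fun _ => hT, fun _ => le_rfl, fun x y => ?_,
      fun i => i.elim0, fun _ _ => rfl⟩
    rw [sub_self, abs_zero]
    exact mul_nonneg hL.le (Finset.sum_nonneg fun j _ => abs_nonneg _)
  | succ m ih =>
    obtain ⟨g, hgc, hg0, hgT, hgL, hgz, hgt⟩ := ih fun i => p i.succ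
    let D : (Fin d → ℝ) → ℝ := fun x => ∑ j, |x j - p 0 j|
    have hDc : Continuous D := by fun_prop
    have hDL : ∀ x y, |D x - D y| ≤ ∑ j, |x j - y j| := by
      intro x y
      rw [← Finset.sum_sub_distrib]
      refine (Finset.abs_sum_le_sum_abs _ _).trans (Finset.sum_le_sum fun j _ => ?_)
      refine (abs_abs_sub_abs_le_abs_sub _ _).trans (le_of_eq ?_)
      ring_nf
    -- A new point contributes a truncated ramp in the distance `D`; minima and maxima preserve the
    -- Lipschitz constant, whatever the number of points.
    refine ⟨fun x => min (g x) (max 0 (L * (D x - a))), by fun_prop,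
      fun x => le_min (hg0 x) (le_max_left _ _), fun x => (min_le_left _ _).trans (hgT x),
      fun x y => ?_, fun i => ?_, fun x hx => ?_⟩
    · refine (abs_min_sub_min_le_max _ _ _ _).trans (max_le (hgL x y) ?_)
      refine (abs_max_sub_max_le_max _ _ _ _).trans (max_le ?_ ?_)
      · rw [sub_self, abs_zero]
        exact mul_nonneg hL.le (Finset.sum_nonneg fun j _ => abs_nonneg _)
      · rw [← mul_sub, abs_mul, abs_of_pos hL, sub_sub_sub_cancel_right]
        exact mul_le_mul_of_nonneg_left (hDL x y) hL.le
    · refine Fin.cases ?_ (fun i => ?_) i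
      · intro x hx
        change min (g x) (max 0 (L * (D x - a))) = 0
        rw [max_eq_left (mul_nonpos_of_nonneg_of_nonpos hL.le (sub_nonpos.2 hx))]
        exact min_eq_right (hg0 x)
      · intro x hx
        beta_reduce
        rw [hgz i x hx]
        exact min_eq_left (le_max_left _ _)
    · beta_reduce
      rw [hgt x fun i => hx i.succ]
      refine min_eq_left (le_max_of_le_right ?_)
      have := hx 0
      have h2 : T / L ≤ D x - a := by linarith
      rwa [div_le_iff₀' hL] at h2

/-- If a family of functions indexed by multi-indices is closed under partial differentiation, the
partial derivatives of its members are found in the family. -/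
theorem iteratedFDeriv_family_apply {d : ℕ} {f : (Fin d → ℕ) → (Fin d → ℝ) → ℝ}
    (hf : ∀ β, ContDiff ℝ (⊤ : ℕ∞) (f β))
    (hd : ∀ β i x, fderiv ℝ (f β) x (Pi.single i 1) = f (β + Pi.single i 1) x)
    (β : Fin d → ℕ) (k : ℕ) (i : Fin k → Fin d) (x : Fin d → ℝ) :
    (iteratedFDeriv ℝ k (f β) x fun j => Pi.single (i j) 1) =
      f (β + ∑ j, Pi.single (i j) 1) x := by
  induction k generalizing x with
  | zero => simp
  | succ k ih =>
    have hdiff : Differentiable ℝ (iteratedFDeriv ℝ k (f β)) :=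
      (hf β).differentiable_iteratedFDeriv (by exact_mod_cast ENat.natCast_lt_top k)
    rw [iteratedFDeriv_succ_apply_left, ← fderiv_continuousMultilinear_apply_const_apply (hdiff x)]
    have : (fun y => iteratedFDeriv ℝ k (f β) y (Fin.tail fun j => (Pi.single (i j) 1 : Fin d → ℝ))) =
        f (β + ∑ j : Fin k, Pi.single (i j.succ) 1) := by
      funext y
      exact ih (fun j => i j.succ) y
    rw [this, hd, Fin.sum_univ_succ, add_assoc, add_comm (Pi.single (i 0) 1)]

theorem sum_sum_single {d k : ℕ} (i : Fin k → Fin d) :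
    ∑ l, (∑ j, Pi.single (i j) 1 : Fin d → ℕ) l = k := by
  simp only [Finset.sum_apply]
  rw [Finset.sum_comm]
  simp

/-- The tensor product kernel with a multi-index. -/
def prodKernel {d : ℕ} (κ : ℕ → ℝ → ℝ) (β : Fin d → ℕ) (y : Fin d → ℝ) : ℝ :=
  ∏ j, κ (β j) (y j)

section prodKernel

variable {d : ℕ} {κ : ℕ → ℝ → ℝ} {η : ℝ}

theorem contDiff_prodKernel (hκ : ∀ m, ContDiff ℝ (⊤ : ℕ∞) (κ m)) (β : Fin d → ℕ) :
    ContDiff ℝ (⊤ : ℕ∞) (prodKernel κ β) :=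
  contDiff_prod fun j _ => (hκ _).comp (contDiff_apply ℝ ℝ j)

theorem prodKernel_eq_zero (h0 : ∀ m t, η < |t| → κ m t = 0) (β : Fin d → ℕ) {y : Fin d → ℝ}
    {j : Fin d} (hj : η < |y j|) : prodKernel κ β y = 0 :=
  Finset.prod_eq_zero (Finset.mem_univ j) (h0 _ _ hj)

theorem hasCompactSupport_prodKernel (h0 : ∀ m t, η < |t| → κ m t = 0) (β : Fin d → ℕ) :
    HasCompactSupport (prodKernel κ β) := by
  refine HasCompactSupport.intro (isCompact_closedBall (0 : Fin d → ℝ) |η|) fun y hy => ?_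
  by_contra h
  have h1 : ∀ j, |y j| ≤ η := by
    intro j
    by_contra! h2
    exact h (prodKernel_eq_zero h0 β h2)
  refine hy (mem_closedBall_zero_iff.2 ?_)
  exact (pi_norm_le_iff_of_nonneg (abs_nonneg η)).2 fun j => (h1 j).trans (le_abs_self η)

theorem fderiv_prodKernel_single
    (hd : ∀ m t, HasDerivAt (κ m) (κ (m + 1) t) t) (β : Fin d → ℕ) (i : Fin d) (y : Fin d → ℝ) :
    fderiv ℝ (prodKernel κ β) y (Pi.single i 1) = prodKernel κ (β + Pi.single i 1) y := by
  have h : HasFDerivAt (prodKernel κ β) _ y := HasFDerivAt.finsetProd (u := Finset.univ)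
    (g := fun j (y : Fin d → ℝ) => κ (β j) (y j)) fun j _ =>
      (hd (β j) (y j)).comp_hasFDerivAt y (hasFDerivAt_apply (𝕜 := ℝ) (F' := fun _ : Fin d => ℝ) j y)
  rw [h.fderiv]
  simp only [sum_apply, smul_apply, smul_eq_mul,
    ContinuousLinearMap.proj_apply]
  rw [Finset.sum_eq_single i]
  · rw [prodKernel, ← Finset.prod_erase_mul _ _ (Finset.mem_univ i)]
    simp only [Pi.add_apply, Pi.single_eq_same, mul_one]
    congr 1
    refine Finset.prod_congr rfl fun j hj => ?_
    simp [Finset.ne_of_mem_erase hj]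
  · intro j _ hj
    simp [hj]
  · simp

theorem integral_abs_prodKernel_le {r : ℕ} {B : ℝ}
    (hκ : ∀ m ≤ r, ∫ t, |κ m t| ≤ B ^ m) (β : Fin d → ℕ) (hβ : ∑ j, β j ≤ r) :
    ∫ y, |prodKernel κ β y| ≤ B ^ ∑ j, β j := by
  simp only [prodKernel, Finset.abs_prod]
  rw [integral_fintype_prod_volume_eq_prod fun j t => |κ (β j) t|, ← Finset.prod_pow_eq_pow_sum]
  refine Finset.prod_le_prod (fun j _ => integral_nonneg fun t => abs_nonneg _) fun j _ => ?_
  exact hκ _ ((Finset.single_le_sum (fun j _ => Nat.zero_le (β j)) (Finset.mem_univ j)).trans hβ)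

/-- The convolution of `g` with a tensor product kernel. -/
noncomputable def mollify (κ : ℕ → ℝ → ℝ) (g : (Fin d → ℝ) → ℝ) (β : Fin d → ℕ) : (Fin d → ℝ) → ℝ :=
  convolution g (prodKernel κ β) (ContinuousLinearMap.mul ℝ ℝ) volume

theorem mollify_apply (κ : ℕ → ℝ → ℝ) (g : (Fin d → ℝ) → ℝ) (β : Fin d → ℕ) (x : Fin d → ℝ) :
    mollify κ g β x = ∫ y, g (x - y) * prodKernel κ β y := by
  rw [mollify, convolution_eq_swap]
  rfl

theorem contDiff_mollify (hκ : ∀ m, ContDiff ℝ (⊤ : ℕ∞) (κ m))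
    (h0 : ∀ m t, η < |t| → κ m t = 0) {g : (Fin d → ℝ) → ℝ} (hg : Continuous g)
    (β : Fin d → ℕ) : ContDiff ℝ (⊤ : ℕ∞) (mollify κ g β) :=
  (hasCompactSupport_prodKernel h0 β).contDiff_convolution_right _ hg.locallyIntegrable
    (contDiff_prodKernel hκ β)

theorem fderiv_mollify_single (hκ : ∀ m, ContDiff ℝ (⊤ : ℕ∞) (κ m))
    (hd : ∀ m t, HasDerivAt (κ m) (κ (m + 1) t) t) (h0 : ∀ m t, η < |t| → κ m t = 0)
    {g : (Fin d → ℝ) → ℝ} (hg : Continuous g) (β : Fin d → ℕ) (i : Fin d) (x : Fin d → ℝ) :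
    fderiv ℝ (mollify κ g β) x (Pi.single i 1) = mollify κ g (β + Pi.single i 1) x := by
  have hc1 : ContDiff ℝ 1 (prodKernel κ β) := (contDiff_prodKernel hκ β).of_le (by simp)
  have hs := hasCompactSupport_prodKernel h0 β
  rw [mollify, (hs.hasFDerivAt_convolution_right (ContinuousLinearMap.mul ℝ ℝ)
    hg.locallyIntegrable hc1 x).fderiv, convolution_precompR_apply _ hg.locallyIntegrable
    (hs.fderiv ℝ) (hc1.continuous_fderiv one_ne_zero), mollify]
  congr 1
  funext y
  exact fderiv_prodKernel_single hd β i y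

theorem integrable_mul_prodKernel (hκ : ∀ m, ContDiff ℝ (⊤ : ℕ∞) (κ m))
    (h0 : ∀ m t, η < |t| → κ m t = 0) {g : (Fin d → ℝ) → ℝ} (hg : Continuous g)
    (β : Fin d → ℕ) : Integrable fun y => g y * prodKernel κ β y :=
  (hg.mul (contDiff_prodKernel hκ β).continuous).integrable_of_hasCompactSupport
    (hasCompactSupport_prodKernel h0 β).mul_left

/-- One derivative can be charged to the Lipschitz constant of `g` instead of the kernel: increments
along a coordinate axis pass under the integral, and their `ℓ₁` length is `|t|`. -/
theorem abs_fderiv_mollify_single_le (hκ : ∀ m, ContDiff ℝ (⊤ : ℕ∞) (κ m))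
    (h0 : ∀ m t, η < |t| → κ m t = 0) {g : (Fin d → ℝ) → ℝ} (hg : Continuous g) {L : ℝ}
    (hL : 0 ≤ L) (hgL : ∀ x y, |g x - g y| ≤ L * ∑ j, |x j - y j|) (β : Fin d → ℕ) (i : Fin d)
    (x : Fin d → ℝ) :
    |fderiv ℝ (mollify κ g β) x (Pi.single i 1)| ≤ L * ∫ y, |prodKernel κ β y| := by
  have hdiff : HasFDerivAt (mollify κ g β) (fderiv ℝ (mollify κ g β) x)
      (x + (0 : ℝ) • Pi.single i 1) := by
    rw [zero_smul, add_zero]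
    exact ((contDiff_mollify hκ h0 hg β).differentiable (by simp) x).hasFDerivAt
  have hline : HasDerivAt (fun t : ℝ => x + t • (Pi.single i 1 : Fin d → ℝ)) (Pi.single i 1) 0 := by
    simpa using ((hasDerivAt_id (0 : ℝ)).smul_const (Pi.single i 1 : Fin d → ℝ)).const_add x
  have hder := hdiff.comp_hasDerivAt 0 hline
  have hI : 0 ≤ ∫ y, |prodKernel κ β y| := integral_nonneg fun y => abs_nonneg _
  rw [← Real.norm_eq_abs]
  refine hder.le_of_lip' (mul_nonneg hL hI) (Filter.Eventually.of_forall fun t => ?_)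
  simp only [Function.comp_apply, zero_smul, add_zero, sub_zero, mollify_apply, Real.norm_eq_abs]
  have hi : ∀ z : Fin d → ℝ, Integrable fun y => g (z - y) * prodKernel κ β y := fun z =>
    integrable_mul_prodKernel (g := fun y => g (z - y)) hκ h0 (by fun_prop) β
  have hK : Integrable fun y => |prodKernel κ β y| :=
    (integrable_mul_prodKernel (g := fun _ => 1) hκ h0 continuous_const β).abs.congr
      (Filter.Eventually.of_forall fun y => by simp)
  rw [← integral_sub (hi _) (hi _)]
  calc _ ≤ ∫ y, L * |t| * |prodKernel κ β y| := by
        rw [← Real.norm_eq_abs]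
        refine norm_integral_le_of_norm_le (hK.const_mul _) (Filter.Eventually.of_forall fun y => ?_)
        rw [← sub_mul, norm_mul, Real.norm_eq_abs, Real.norm_eq_abs]
        refine mul_le_mul_of_nonneg_right ((hgL _ _).trans (le_of_eq ?_)) (abs_nonneg _)
        congr 1
        rw [Finset.sum_eq_single i]
        · simp
        · intro j _ hj
          simp [hj]
        · simp
    _ = _ := by rw [integral_const_mul]; ring

end prodKernel

/-- A smooth function that vanishes at prescribed points and is constant outside `ℓ₁`-balls around
them. -/
theorem exists_fooling_integration {r : ℕ} (hr : 1 ≤ r) : ∃ M : ℝ, 1 ≤ M ∧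
    ∀ (d m : ℕ) (η T : ℝ), 0 < η → η ≤ 1 → 0 ≤ T → T ≤ 1 → ∀ p : Fin m → Fin d → ℝ,
      ∃ f ∈ smoothClass r d, (∀ i, f (p i) = 0) ∧ (∀ x, 0 ≤ f x) ∧
        ∀ x, (∀ i, 2 * d * η + T / (η / M) ^ (r - 1) ≤ ∑ j, |x j - p i j|) → f x = T := by
  obtain ⟨M, hM, hker⟩ := exists_kernel r
  refine ⟨M, hM, fun d m η T hη hη1 hT hT1 p => ?_⟩
  obtain ⟨κ, hκ, hd, h0, hpos, hint, hB⟩ := hker η hη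
  have hL : 0 < (η / M) ^ (r - 1) := by positivity
  -- The kernel lives on a cube of half-width `η`, contained in the `ℓ₁`-ball of radius `d * η`; a
  -- zero zone of that radius survives mollification at the nodes.
  obtain ⟨g, hgc, hg0, hgT, hgL, hgz, hgt⟩ := exists_ramp p (a := d * η) hL hT
  have hkpos : ∀ y, 0 ≤ prodKernel κ (0 : Fin d → ℕ) y := fun y =>
    Finset.prod_nonneg fun j _ => hpos _
  have hkint : ∫ y, prodKernel κ (0 : Fin d → ℕ) y = 1 := by
    simp only [prodKernel, Pi.zero_apply]
    rw [integral_fintype_prod_volume_eq_pow fun t => κ 0 t, hint, one_pow]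
  have hsmall : ∀ y : Fin d → ℝ, prodKernel κ 0 y ≠ 0 → ∑ j, |y j| ≤ d * η := by
    intro y hy
    calc ∑ j, |y j| ≤ ∑ _j : Fin d, η := Finset.sum_le_sum fun j _ => by
          by_contra! h
          exact hy (prodKernel_eq_zero h0 0 h)
      _ = d * η := by simp
  have hK : Integrable fun y => prodKernel κ (0 : Fin d → ℕ) y :=
    (integrable_mul_prodKernel (g := fun _ => 1) hκ h0 continuous_const 0).congr
      (Filter.Eventually.of_forall fun y => by simp)
  have hf0 : ∀ x, 0 ≤ mollify κ g 0 x := fun x => by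
    rw [mollify_apply]
    exact integral_nonneg fun y => mul_nonneg (hg0 _) (hkpos y)
  have hfT : ∀ x, mollify κ g 0 x ≤ T := fun x => by
    rw [mollify_apply]
    calc _ ≤ ∫ y, T * prodKernel κ (0 : Fin d → ℕ) y :=
          integral_mono (integrable_mul_prodKernel (g := fun y => g (x - y)) hκ h0 (by fun_prop) 0)
            (hK.const_mul T) fun y => mul_le_mul_of_nonneg_right (hgT _) (hkpos y)
      _ = T := by rw [integral_const_mul, hkint, mul_one]
  refine ⟨mollify κ g 0, mem_smoothClass_of_contDiff
    ((contDiff_mollify hκ h0 hgc 0).of_le (by exact_mod_cast le_top))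
      fun k hk i x => ?_, fun i => ?_, hf0, fun x hx => ?_⟩
  · rw [iteratedFDeriv_family_apply (contDiff_mollify hκ h0 hgc)
      (fderiv_mollify_single hκ hd h0 hgc), zero_add]
    cases k with
    | zero =>
      simp only [Finset.univ_eq_empty, Finset.sum_empty]
      rw [abs_of_nonneg (hf0 x)]
      exact (hfT x).trans hT1
    | succ k =>
      -- Of the `k + 1` derivatives, one falls on the ramp and gives `(η / M) ^ (r - 1)`; the other
      -- `k ≤ r - 1` fall on the kernel and cost `(M / η) ^ k`.
      rw [Fin.sum_univ_succ, add_comm, ← fderiv_mollify_single hκ hd h0 hgc]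
      refine (abs_fderiv_mollify_single_le hκ h0 hgc hL.le hgL _ _ x).trans ?_
      have hsum := sum_sum_single fun j : Fin k => i j.succ
      have := integral_abs_prodKernel_le hB
        (∑ j : Fin k, Pi.single (i j.succ) 1) (by rw [hsum]; omega)
      rw [hsum] at this
      calc _ ≤ (η / M) ^ (r - 1) * (M / η) ^ k := mul_le_mul_of_nonneg_left this hL.le
        _ ≤ (η / M) ^ k * (M / η) ^ k := by
          refine mul_le_mul_of_nonneg_right ?_ (by positivity)
          exact pow_le_pow_of_le_one (by positivity)
            ((div_le_one (by linarith)).2 (hη1.trans hM)) (by omega)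
        _ = 1 := by
          rw [← mul_pow]
          have : η / M * (M / η) = 1 := by
            have : M ≠ 0 := by linarith
            field_simp
          rw [this, one_pow]
  · rw [mollify_apply]
    refine integral_eq_zero_of_ae (Filter.Eventually.of_forall fun y => ?_)
    by_cases hy : prodKernel κ 0 y = 0
    · simp [hy]
    · have : g (p i - y) = 0 := hgz i _ (by simpa using hsmall y hy)
      simp [this]
  · rw [mollify_apply]
    have : ∀ y, g (x - y) * prodKernel κ 0 y = T * prodKernel κ 0 y := by
      intro y
      by_cases hy : prodKernel κ 0 y = 0
      · simp [hy]
      -- The second `d * η` in the radius pays for the reach of the kernel.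
      · rw [hgt (x - y) fun i => ?_]
        have h1 := hx i
        have h2 := hsmall y hy
        have h3 : ∑ j, |x j - p i j| ≤ ∑ j, |(x - y) j - p i j| + ∑ j, |y j| := by
          rw [← Finset.sum_add_distrib]
          refine Finset.sum_le_sum fun j _ => ?_
          calc |x j - p i j| = |((x - y) j - p i j) + y j| := by simp; ring_nf
            _ ≤ _ := abs_add_le _ _
        linarith
    simp only [this]
    rw [integral_const_mul, hkint, mul_one]

/-! ### A radial bump function with dimension-free derivative bounds -/

/-- The first derivative is the linear map `A` of norm at most two, the second is constant, and
higher ones vanish. Nothing depends on the dimension. -/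
theorem norm_iteratedFDeriv_norm_sq_le {E : Type*} [NormedAddCommGroup E] [InnerProductSpace ℝ E]
    {u : E} (hu : ‖u‖ ≤ 1) {k : ℕ} (hk : 1 ≤ k) :
    ‖iteratedFDeriv ℝ k (fun v : E => ‖v‖ ^ 2) u‖ ≤ 2 ^ k := by
  let A : E →L[ℝ] E →L[ℝ] ℝ := innerSL ℝ + innerSL ℝ
  have hAv : ∀ v, A v = innerSL ℝ v + innerSL ℝ v := fun v => rfl
  have hA : ‖A‖ ≤ 2 := by
    refine A.opNorm_le_bound zero_le_two fun v => ?_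
    rw [hAv]
    refine (norm_add_le _ _).trans (le_of_eq ?_)
    rw [innerSL_apply_norm, two_mul]
  have hder : fderiv ℝ (fun v : E => ‖v‖ ^ 2) = A := by
    funext v
    rw [fderiv_norm_sq_apply, hAv, two_nsmul]
  obtain ⟨k, rfl⟩ : ∃ n, k = n + 1 := ⟨k - 1, by omega⟩
  rw [← norm_iteratedFDeriv_fderiv, hder]
  match k with
  | 0 =>
    rw [norm_iteratedFDeriv_zero]
    calc ‖A u‖ ≤ ‖A‖ * ‖u‖ := A.le_opNorm u
      _ ≤ 2 * 1 := by gcongr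
      _ = 2 ^ (0 + 1) := by norm_num
  | k + 1 =>
    have hA' : fderiv ℝ A = fun _ => A := by
      funext v
      exact A.fderiv
    rw [← norm_iteratedFDeriv_fderiv, hA']
    match k with
    | 0 =>
      rw [norm_iteratedFDeriv_zero]
      exact hA.trans (by norm_num)
    | k + 1 =>
      rw [iteratedFDeriv_succ_const]
      simp

/-- The profile of the bump function. -/
noncomputable def bumpProfile (s : ℝ) : ℝ := Real.smoothTransition (1 - s)

theorem contDiff_bumpProfile {n : ℕ∞} : ContDiff ℝ n bumpProfile :=
  Real.smoothTransition.contDiff.comp (contDiff_const.sub contDiff_id)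

/-- On the unit ball the chain rule combines bounds for the profile on `[0, 1]` with those for the
squared norm, neither involving `d`; outside the ball the function lies off its support. -/
theorem exists_norm_iteratedFDeriv_bump_le (r : ℕ) : ∃ M : ℝ, 1 ≤ M ∧ ∀ (d k : ℕ), k ≤ r →
    ∀ u : EuclideanSpace ℝ (Fin d),
      ‖iteratedFDeriv ℝ k (fun v : EuclideanSpace ℝ (Fin d) => bumpProfile (‖v‖ ^ 2)) u‖ ≤ M := by
  have hbd : ∀ k : ℕ, ∃ C, ∀ s ∈ Set.Icc (0 : ℝ) 1, ‖iteratedFDeriv ℝ k bumpProfile s‖ ≤ C :=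
    fun k => isCompact_Icc.exists_bound_of_continuousOn
      ((contDiff_bumpProfile (n := k)).continuous_iteratedFDeriv le_rfl).continuousOn
  choose C hC using hbd
  let B := ∑ k ∈ Finset.range (r + 1), |C k|
  have hB : ∀ k ≤ r, ∀ s ∈ Set.Icc (0 : ℝ) 1, ‖iteratedFDeriv ℝ k bumpProfile s‖ ≤ B :=
    fun k hk s hs => (hC k s hs).trans ((le_abs_self _).trans
      (Finset.single_le_sum (f := fun k => |C k|) (fun k _ => abs_nonneg _)
        (Finset.mem_range.2 (Nat.lt_succ_of_le hk))))
  have hB0 : 0 ≤ B := Finset.sum_nonneg fun k _ => abs_nonneg _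
  refine ⟨1 + r.factorial * B * 2 ^ r, le_add_of_nonneg_right (by positivity),
    fun d k hk u => ?_⟩
  by_cases hu : ‖u‖ ≤ 1
  · have hsm : ContDiff ℝ (r : ℕ∞) fun v : EuclideanSpace ℝ (Fin d) => ‖v‖ ^ 2 := contDiff_norm_sq ℝ
    have hs : ‖u‖ ^ 2 ∈ Set.Icc (0 : ℝ) 1 := ⟨by positivity, by
      have := norm_nonneg u
      nlinarith⟩
    have h := norm_iteratedFDeriv_comp_le (n := k) (contDiff_bumpProfile (n := r)) hsm
      (by exact_mod_cast hk) u (C := B) (D := 2) (fun i hi => hB i (hi.trans hk) _ hs)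
      fun i hi _ => norm_iteratedFDeriv_norm_sq_le hu hi
    refine h.trans ?_
    have h1 : (k.factorial : ℝ) ≤ r.factorial := by exact_mod_cast Nat.factorial_le hk
    have h2 : (2 : ℝ) ^ k ≤ 2 ^ r := pow_le_pow_right₀ one_le_two hk
    calc _ ≤ (r.factorial : ℝ) * B * 2 ^ r := by gcongr
      _ ≤ _ := by linarith
  · have hts : u ∉ tsupport (iteratedFDeriv ℝ k
        fun v : EuclideanSpace ℝ (Fin d) => bumpProfile (‖v‖ ^ 2)) := by
      intro h
      have h1 : tsupport (fun v : EuclideanSpace ℝ (Fin d) => bumpProfile (‖v‖ ^ 2)) ⊆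
          Metric.closedBall 0 1 := by
        refine closure_minimal (fun v hv => ?_) Metric.isClosed_closedBall
        rw [mem_closedBall_zero_iff]
        by_contra! h2
        exact hv (Real.smoothTransition.zero_of_nonpos (by nlinarith))
      exact hu (mem_closedBall_zero_iff.1 (h1 (tsupport_iteratedFDeriv_subset k h)))
    rw [image_eq_zero_of_notMem_tsupport hts, norm_zero]
    positivity

/-- A smooth peak supported in a small Euclidean ball. -/
theorem exists_fooling_recovery (r : ℕ) : ∃ M : ℝ, 1 ≤ M ∧ ∀ (d : ℕ) (ρ : ℝ), 0 < ρ → ρ ≤ 1 →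
    ∀ z : Fin d → ℝ, ∃ f ∈ smoothClass r d, Continuous f ∧ f z = ρ ^ r / M ∧
      ∀ x, ρ ^ 2 ≤ ∑ j, (x j - z j) ^ 2 → f x = 0 := by
  obtain ⟨M, hM, hbd⟩ := exists_norm_iteratedFDeriv_bump_le r
  have hM0 : 0 < M := by linarith
  refine ⟨M, hM, fun d ρ hρ hρ1 z => ?_⟩
  let G : EuclideanSpace ℝ (Fin d) → ℝ := fun v => bumpProfile (‖v‖ ^ 2)
  have hG : ContDiff ℝ r G := (contDiff_bumpProfile (n := r)).comp (contDiff_norm_sq ℝ)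
  -- Passing to the Euclidean norm and dividing by `ρ` sends coordinate vectors to vectors of length
  -- `ρ⁻¹`, so a derivative of order `k` costs `M * ρ⁻¹ ^ k`, absorbed by the height `ρ ^ r / M`.
  let A : (Fin d → ℝ) →L[ℝ] EuclideanSpace ℝ (Fin d) :=
    ρ⁻¹ • ((EuclideanSpace.equiv (Fin d) ℝ).symm : (Fin d → ℝ) →L[ℝ] EuclideanSpace ℝ (Fin d))
  have hAj : ∀ y j, A y j = ρ⁻¹ * y j := fun y j => rfl
  have hA : ∀ y, ‖A y‖ ^ 2 = (∑ j, y j ^ 2) / ρ ^ 2 := by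
    intro y
    rw [EuclideanSpace.norm_sq_eq, Finset.sum_div]
    refine Finset.sum_congr rfl fun j _ => ?_
    rw [hAj, Real.norm_eq_abs, sq_abs]
    field_simp
  have hAs : ∀ j, ‖A (Pi.single j 1)‖ = ρ⁻¹ := by
    intro j
    have h := hA (Pi.single j 1)
    rw [Finset.sum_eq_single j (by intro i _ hi; simp [hi]) (by simp), Pi.single_eq_same, one_pow,
      one_div, ← inv_pow] at h
    exact (pow_left_inj₀ (norm_nonneg _) (inv_nonneg.2 hρ.le) two_ne_zero).1 h
  have hGA : ContDiff ℝ r (G ∘ A) := hG.comp A.contDiff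
  have hGA' : ContDiff ℝ r fun x => (G ∘ A) (x - z) := hGA.comp (contDiff_id.sub contDiff_const)
  have hf : ContDiff ℝ r ((ρ ^ r / M) • fun x => (G ∘ A) (x - z)) := contDiff_const.smul hGA'
  refine ⟨(ρ ^ r / M) • fun x => (G ∘ A) (x - z), mem_smoothClass_of_contDiff hf
    fun k hk i x => ?_, hf.continuous, ?_, fun x hx => ?_⟩
  · rw [iteratedFDeriv_const_smul_apply (hGA'.of_le (by exact_mod_cast hk)).contDiffAt,
      iteratedFDeriv_comp_sub, A.iteratedFDeriv_comp_right hG _ (by exact_mod_cast hk)]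
    rw [smul_apply, smul_eq_mul, abs_mul, abs_of_nonneg (by positivity),
      ContinuousMultilinearMap.compContinuousLinearMap_apply]
    have h1 : |iteratedFDeriv ℝ k G (A (x - z)) fun j => A (Pi.single (i j) 1)| ≤ M * (ρ⁻¹) ^ k := by
      rw [← Real.norm_eq_abs]
      refine (ContinuousMultilinearMap.le_opNorm _ _).trans ?_
      rw [Finset.prod_congr rfl fun j _ => hAs (i j), Finset.prod_const, Finset.card_univ,
        Fintype.card_fin]
      exact mul_le_mul_of_nonneg_right (hbd d k hk _) (by positivity)
    calc _ ≤ ρ ^ r / M * (M * (ρ⁻¹) ^ k) := mul_le_mul_of_nonneg_left h1 (by positivity)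
      _ = ρ ^ r * (ρ⁻¹) ^ k := by field_simp
      _ ≤ ρ ^ k * (ρ⁻¹) ^ k := by
        exact mul_le_mul_of_nonneg_right (pow_le_pow_of_le_one hρ.le hρ1 hk) (by positivity)
      _ = 1 := by rw [← mul_pow, mul_inv_cancel₀ hρ.ne', one_pow]
  · simp [G, bumpProfile]
  · have : (1 : ℝ) ≤ ‖A (x - z)‖ ^ 2 := by
      rw [hA, one_le_div (by positivity)]
      exact hx
    simp only [Pi.smul_apply, Function.comp_apply, G, bumpProfile]
    rw [Real.smoothTransition.zero_of_nonpos (by linarith), smul_zero]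

/-! ### Complexity bounds -/

theorem rpow_inv_pow {r : ℕ} (hr : 1 ≤ r) {a : ℝ} (ha : 0 ≤ a) : (a ^ (1 / (r : ℝ))) ^ r = a := by
  rw [one_div]
  exact Real.rpow_inv_natCast_pow ha (by omega)

/-- Take `m = ⌈t⌉₊` with `t ^ r = 2 * d / ε`. Rounding up costs a factor two because `t ≥ 1`, and `2
^ (1 / r) ≤ 2` costs another. -/
theorem exists_grid_size {r d : ℕ} (hr : 1 ≤ r) (hd : 1 ≤ d) {ε : ℝ} (hε : 0 < ε) (hε1 : ε ≤ 1) :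
    ∃ m : ℕ, 0 < m ∧ d * (2 * (1 / (m : ℝ)) ^ r) ≤ ε ∧
      (m : ℝ) ≤ 4 * ((d : ℝ) ^ (1 / (r : ℝ)) * ε ^ (-(1 / (r : ℝ)))) := by
  have hd' : (1 : ℝ) ≤ d := by exact_mod_cast hd
  have hr' : (1 : ℝ) ≤ r := by exact_mod_cast hr
  set a : ℝ := 2 * d / ε with ha
  have ha1 : 1 ≤ a := by
    rw [ha, one_le_div hε]
    linarith
  set t : ℝ := a ^ (1 / (r : ℝ)) with ht
  have ht1 : 1 ≤ t := Real.one_le_rpow ha1 (by positivity)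
  have htr : t ^ r = a := rpow_inv_pow hr (by linarith)
  have hm : 0 < ⌈t⌉₊ := Nat.ceil_pos.2 (by linarith)
  have hm' : (0 : ℝ) < ⌈t⌉₊ := by exact_mod_cast hm
  refine ⟨⌈t⌉₊, hm, ?_, ?_⟩
  · have h1 : a ≤ (⌈t⌉₊ : ℝ) ^ r := by
      rw [← htr]
      exact pow_le_pow_left₀ (by linarith) (Nat.le_ceil t) r
    rw [one_div, inv_pow, ← mul_assoc, ← div_eq_mul_inv, div_le_iff₀ (by positivity)]
    calc (d : ℝ) * 2 = ε * a := by rw [ha]; field_simp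
      _ ≤ _ := mul_le_mul_of_nonneg_left h1 hε.le
  · have h2 : (⌈t⌉₊ : ℝ) ≤ 2 * t := by linarith [Nat.ceil_lt_add_one (by linarith : 0 ≤ t)]
    have h3 : t = 2 ^ (1 / (r : ℝ)) * ((d : ℝ) ^ (1 / (r : ℝ)) * ε ^ (-(1 / (r : ℝ)))) := by
      rw [ht, ha, Real.div_rpow (by positivity) hε.le, Real.mul_rpow (by norm_num) (by positivity),
        Real.rpow_neg hε.le]
      ring
    have h4 : (2 : ℝ) ^ (1 / (r : ℝ)) ≤ 2 := by
      calc (2 : ℝ) ^ (1 / (r : ℝ)) ≤ 2 ^ (1 : ℝ) := Real.rpow_le_rpow_of_exponent_le one_le_two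
            ((div_le_one (by linarith)).2 hr')
        _ = 2 := Real.rpow_one 2
    have h5 : 0 ≤ (d : ℝ) ^ (1 / (r : ℝ)) * ε ^ (-(1 / (r : ℝ))) := by positivity
    nlinarith [mul_le_mul_of_nonneg_right h4 h5]

theorem minAppError_mono {d n : ℕ} {F G : Set ((Fin d → ℝ) → ℝ)} (h : F ⊆ G) :
    minAppError n F ≤ minAppError n G :=
  iInf_mono fun _ => iInf_mono fun _ => iInf_mono fun _ => iInf_mono fun _ =>
    biSup_mono h

/-- Ensures that the infimum defining `nApp` is attained, since `sInf ∅ = 0` in `ℕ` would be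
meaningless here. The crude rate from `r = 1` is enough. -/
theorem exists_minAppError_le {r : ℕ} (hr : 1 ≤ r) (d : ℕ) {ε : ℝ} (hε : 0 < ε) :
    ∃ n, minAppError n (smoothClass r d) ≤ ENNReal.ofReal ε := by
  obtain ⟨m, hm⟩ := exists_nat_gt (2 * d / ε)
  have hm0 : (0 : ℝ) < m := lt_of_le_of_lt (by positivity) hm
  refine ⟨(m + 1) ^ d, (minAppError_mono (smoothClass_anti hr)).trans
    ((minAppError_smoothClass_le le_rfl one_le_two d (by exact_mod_cast hm0)).trans
      (ENNReal.ofReal_le_ofReal ?_))⟩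
  rw [div_lt_iff₀ hε] at hm
  rw [pow_one, mul_one_div, mul_div_assoc', div_le_iff₀ hm0]
  linarith

theorem minAppError_nApp_le {r : ℕ} (hr : 1 ≤ r) (d : ℕ) {ε : ℝ} (hε : 0 < ε) :
    minAppError (nApp ε (smoothClass r d)) (smoothClass r d) ≤ ENNReal.ofReal ε :=
  Nat.sInf_mem (s := {n | minAppError n (smoothClass r d) ≤ ENNReal.ofReal ε})
    (exists_minAppError_le hr d hε)

theorem nInt_le_nApp {r : ℕ} (hr : 1 ≤ r) (d : ℕ) {ε : ℝ} (hε : 0 < ε) :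
    nInt ε (smoothClass r d) ≤ nApp ε (smoothClass r d) :=
  Nat.sInf_le ((minIntError_le_minAppError fun _ hf =>
    integrableOn_of_mem_smoothClass hf).trans (minAppError_nApp_le hr d hε))

theorem minIntError_nInt_le {r : ℕ} (hr : 1 ≤ r) (d : ℕ) {ε : ℝ} (hε : 0 < ε) :
    minIntError (nInt ε (smoothClass r d)) (smoothClass r d) ≤ ENNReal.ofReal ε :=
  Nat.sInf_mem (s := {n | minIntError n (smoothClass r d) ≤ ENNReal.ofReal ε})
    ⟨_, (minIntError_le_minAppError fun _ hf =>
      integrableOn_of_mem_smoothClass hf).trans (minAppError_nApp_le hr d hε)⟩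

theorem exists_nInt_le {r : ℕ} (hr : 1 ≤ r) : ∃ C : ℝ, 0 < C ∧ ∀ d : ℕ, 1 ≤ d → ∀ ε : ℝ,
    0 < ε → ε ≤ 1 → (nInt ε (smoothClass r d) : ℝ) ≤
      (C * (d : ℝ) ^ (1 / (r : ℝ)) * ε ^ (-(1 / (r : ℝ)))) ^ d := by
  obtain ⟨q, hq, h⟩ := minIntError_smoothClass_le hr
  refine ⟨4 * q, by positivity, fun d hd ε hε hε1 => ?_⟩
  obtain ⟨m, hm, hm1, hm2⟩ := exists_grid_size hr hd hε hε1
  have h1 : nInt ε (smoothClass r d) ≤ (m * q) ^ d :=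
    Nat.sInf_le ((h d m hm).trans (ENNReal.ofReal_le_ofReal hm1))
  calc (nInt ε (smoothClass r d) : ℝ) ≤ ((m : ℝ) * q) ^ d := by exact_mod_cast h1
    _ ≤ _ := by
      refine pow_le_pow_left₀ (by positivity) ?_ d
      calc (m : ℝ) * q ≤ 4 * ((d : ℝ) ^ (1 / (r : ℝ)) * ε ^ (-(1 / (r : ℝ)))) * q :=
            mul_le_mul_of_nonneg_right hm2 (by positivity)
        _ = _ := by ring

theorem nApp_le {r : ℕ} (hr : 1 ≤ r) (hr2 : r ≤ 2) {d : ℕ} (hd : 1 ≤ d) {ε : ℝ}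
    (hε : 0 < ε) (hε1 : ε ≤ 1) : (nApp ε (smoothClass r d) : ℝ) ≤
      (8 * (d : ℝ) ^ (1 / (r : ℝ)) * ε ^ (-(1 / (r : ℝ)))) ^ d := by
  obtain ⟨m, hm, hm1, hm2⟩ := exists_grid_size hr hd hε hε1
  have h1 : nApp ε (smoothClass r d) ≤ (m + 1) ^ d :=
    Nat.sInf_le ((minAppError_smoothClass_le hr hr2 d hm).trans (ENNReal.ofReal_le_ofReal hm1))
  have hm' : (1 : ℝ) ≤ m := by exact_mod_cast hm
  calc (nApp ε (smoothClass r d) : ℝ) ≤ ((m : ℝ) + 1) ^ d := by exact_mod_cast h1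
    _ ≤ _ := pow_le_pow_left₀ (by positivity) (by linarith) d

theorem exists_le_nInt {r : ℕ} (hr : 1 ≤ r) : ∃ c : ℝ, 0 < c ∧ ∀ d : ℕ, 1 ≤ d → ∀ ε : ℝ,
    0 < ε → ε < 1 / 2 → (c * (d : ℝ) ^ (1 / (r : ℝ)) * ε ^ (-(1 / (r : ℝ)))) ^ d ≤
      (nInt ε (smoothClass r d) : ℝ) := by
  obtain ⟨M, hM, hfool⟩ := exists_fooling_integration hr
  have hM0 : 0 < M := by linarith
  set A : ℝ := 4 * Real.exp 1 * (1 + M ^ (r - 1)) with hA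
  have hA0 : 0 < A := by positivity
  refine ⟨1 / (4 * A), by positivity, fun d hd ε hε hε1 => ?_⟩
  have hd' : (1 : ℝ) ≤ d := by exact_mod_cast hd
  have hd0 : (0 : ℝ) < d := by linarith
  -- With `η ^ r = ε / d` the two terms of the radius `R` below are both of order `d * η`.
  set η : ℝ := (ε / d) ^ (1 / (r : ℝ)) with hη
  have hη0 : 0 < η := Real.rpow_pos_of_pos (by positivity) _
  have hηr : η ^ r = ε / d := rpow_inv_pow hr (by positivity)
  have hη1 : η ≤ 1 := Real.rpow_le_one (by positivity) ((div_le_one hd0).2 (by linarith))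
    (by positivity)
  have hηinv : 1 / (4 * A) * (d : ℝ) ^ (1 / (r : ℝ)) * ε ^ (-(1 / (r : ℝ))) = 1 / (4 * A * η) := by
    rw [hη, Real.div_rpow hε.le hd0.le, Real.rpow_neg hε.le]
    field_simp
  rw [hηinv]
  by_contra! hlt
  set n := nInt ε (smoothClass r d) with hn
  set R : ℝ := 2 * d * η + 2 * ε / (η / M) ^ (r - 1) with hR
  have hReq : 2 * Real.exp 1 * (R / d) = A * η := by
    have h1 : η ^ r = η ^ (r - 1) * η := by rw [← pow_succ, Nat.sub_add_cancel hr]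
    have h2 : ε = η ^ (r - 1) * η * d := by rw [← h1, hηr]; field_simp
    rw [hR, hA, div_pow]
    nth_rewrite 1 [h2]
    field_simp
    ring
  have hR0 : 0 < R := by positivity
  have hvol := volume_sum_abs_le_le hd hR0
  rw [hReq] at hvol
  -- If `n` is too small, the balls around the nodes cover at most a quarter of the cube.
  have hsmall : (n : ℝ) * (A * η) ^ d ≤ 1 / 4 := by
    calc (n : ℝ) * (A * η) ^ d ≤ (1 / (4 * A * η)) ^ d * (A * η) ^ d :=
          mul_le_mul_of_nonneg_right hlt.le (by positivity)
      _ = (1 / 4) ^ d := by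
        rw [← mul_pow]
        congr 1
        field_simp
      _ ≤ (1 / 4) ^ 1 := pow_le_pow_of_le_one (by norm_num) (by norm_num) hd
      _ = 1 / 4 := pow_one _
  have hge : ENNReal.ofReal (3 / 2 * ε) ≤ minIntError n (smoothClass r d) := by
    refine ofReal_le_minIntError fun m hm p => ?_
    -- The plateau `2 * ε`, at most one as `ε < 1 / 2`, on at least three quarters of the cube
    -- yields an integral of `3 / 2 * ε > ε`.
    obtain ⟨f, hf, hfp, hf0, hfT⟩ := hfool d m η (2 * ε) hη0 hη1 (by linarith) (by linarith) p
    refine ⟨f, hf, neg_mem_smoothClass hf, hfp, ?_⟩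
    set U : Set (Fin d → ℝ) := {x | ∃ i, ∑ j, |x j - p i j| ≤ R} with hU
    have hUm : MeasurableSet U := by
      have : U = ⋃ i, {x : Fin d → ℝ | ∑ j, |x j - p i j| ≤ R} := by ext; simp [hU]
      rw [this]
      exact MeasurableSet.iUnion fun i => measurableSet_le (by fun_prop) measurable_const
    have hUv : volume.real (cube d ∩ U) ≤ 1 / 4 := by
      refine ENNReal.toReal_le_of_le_ofReal (by norm_num) ?_
      calc volume (cube d ∩ U) ≤ volume U := measure_mono Set.inter_subset_right
        _ ≤ m * ENNReal.ofReal ((A * η) ^ d) := volume_exists_sum_sub_le_le (ψ := fun t => |t|) hvol p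
        _ = ENNReal.ofReal (m * (A * η) ^ d) := by
          rw [ENNReal.ofReal_mul (by positivity), ENNReal.ofReal_natCast]
        _ ≤ ENNReal.ofReal (1 / 4) := by
          refine ENNReal.ofReal_le_ofReal (le_trans ?_ hsmall)
          gcongr
    have hdiff : 3 / 4 ≤ volume.real (cube d \ U) := by
      have h1 := measureReal_inter_add_sdiff (μ := volume) (s := cube d) (t := U) hUm
        (by simp [volume_cube])
      have h2 : volume.real (cube d) = 1 := by simp [measureReal_def, volume_cube]
      linarith
    have hfi := integrableOn_of_mem_smoothClass hf
    calc 3 / 2 * ε ≤ 2 * ε * volume.real (cube d \ U) := by nlinarith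
      _ = ∫ _ in cube d \ U, 2 * ε := by
        rw [setIntegral_const, smul_eq_mul, mul_comm]
      _ = ∫ x in cube d \ U, f x := by
        refine setIntegral_congr_fun ((measurableSet_cube d).diff hUm) fun x hx => ?_
        refine (hfT x fun i => ?_).symm
        by_contra! h
        exact hx.2 ⟨i, h.le⟩
      _ ≤ ∫ x in cube d, f x :=
        setIntegral_mono_set hfi (Filter.Eventually.of_forall hf0)
          (Filter.Eventually.of_forall Set.sdiff_subset)
  have h1 := hge.trans (minIntError_nInt_le hr d hε)
  rw [ENNReal.ofReal_le_ofReal_iff hε.le] at h1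
  linarith

theorem exists_le_nApp {r : ℕ} (hr : 1 ≤ r) : ∃ c ε₀ : ℝ, 0 < c ∧ 0 < ε₀ ∧ ∀ d : ℕ, 1 ≤ d →
    ∀ ε : ℝ, 0 < ε → ε < ε₀ → (c * √d * ε ^ (-(1 / (r : ℝ)))) ^ d ≤
      (nApp ε (smoothClass r d) : ℝ) := by
  obtain ⟨M, hM, hfool⟩ := exists_fooling_recovery r
  have hM0 : 0 < M := by linarith
  set A : ℝ := Real.exp 1 * √Real.pi with hA
  have hA0 : 0 < A := mul_pos (Real.exp_pos 1) (Real.sqrt_pos.2 Real.pi_pos)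
  set B : ℝ := (4 * M) ^ (1 / (r : ℝ)) with hB
  have hB0 : 0 < B := Real.rpow_pos_of_pos (by positivity) _
  refine ⟨1 / (A * B), 1 / (4 * M), by positivity, by positivity, fun d hd ε hε hε1 => ?_⟩
  have hd0 : (0 : ℝ) < d := by exact_mod_cast hd
  have hsd : 0 < √(d : ℝ) := Real.sqrt_pos.2 hd0
  -- The peak then has height `ρ ^ r / M = 4 * ε`, safely above `2 * ε`; the threshold `1 / (4 * M)`
  -- keeps `ρ ≤ 1`.
  set ρ : ℝ := (4 * M * ε) ^ (1 / (r : ℝ)) with hρ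
  have hρ0 : 0 < ρ := Real.rpow_pos_of_pos (by positivity) _
  have hρr : ρ ^ r = 4 * M * ε := rpow_inv_pow hr (by positivity)
  have hρ1 : ρ ≤ 1 := by
    refine Real.rpow_le_one (by positivity) ?_ (by positivity)
    rw [lt_div_iff₀ (by positivity)] at hε1
    linarith
  have hρinv : 1 / (A * B) * √(d : ℝ) * ε ^ (-(1 / (r : ℝ))) = 1 / (A * (ρ / √d)) := by
    rw [hρ, Real.mul_rpow (by positivity) hε.le, ← hB, Real.rpow_neg hε.le]
    field_simp
  rw [hρinv]
  by_contra! hlt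
  set n := nApp ε (smoothClass r d) with hn
  have hv0 : 0 < A * (ρ / √d) := by positivity
  have hvol := volume_sum_sq_le_le hd hρ0
  have hsmall : (n : ℝ) * (A * (ρ / √d)) ^ d < 1 := by
    calc (n : ℝ) * (A * (ρ / √d)) ^ d < (1 / (A * (ρ / √d))) ^ d * (A * (ρ / √d)) ^ d :=
          mul_lt_mul_of_pos_right hlt (by positivity)
      _ = 1 := by rw [← mul_pow, one_div, inv_mul_cancel₀ hv0.ne', one_pow]
  have hge : ENNReal.ofReal (2 * ε) ≤ minAppError n (smoothClass r d) := by
    refine ofReal_le_minAppError fun m hm p => ?_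
    set U : Set (Fin d → ℝ) := {x | ∃ i, ∑ j, (x j - p i j) ^ 2 ≤ ρ ^ 2} with hU
    -- The peak is centred in the open cube so that a neighbourhood of its centre counts towards the
    -- measure.
    set I : Set (Fin d → ℝ) := Set.univ.pi fun _ => Set.Ioo (0 : ℝ) 1 with hI
    have hIo : IsOpen I := isOpen_set_pi Set.finite_univ fun _ _ => isOpen_Ioo
    have hIc : I ⊆ cube d := by
      rw [cube_eq_pi]
      exact Set.pi_mono fun _ _ => Set.Ioo_subset_Icc_self
    have hUv : volume U < 1 := by
      calc volume U ≤ m * ENNReal.ofReal ((A * (ρ / √d)) ^ d) :=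
            volume_exists_sum_sub_le_le (ψ := fun t => t ^ 2) hvol p
        _ = ENNReal.ofReal (m * (A * (ρ / √d)) ^ d) := by
          rw [ENNReal.ofReal_mul (by positivity), ENNReal.ofReal_natCast]
        _ < 1 := by
          rw [ENNReal.ofReal_lt_one]
          refine lt_of_le_of_lt ?_ hsmall
          gcongr
    obtain ⟨z, hzI, hzU⟩ : ∃ z ∈ I, z ∉ U := by
      by_contra! h
      have h1 : volume I ≤ volume U := measure_mono h
      rw [hI, volume_pi_pi] at h1
      simp only [Real.volume_Ioo, sub_zero, ENNReal.ofReal_one, Finset.prod_const_one] at h1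
      exact absurd h1 (not_le.2 hUv)
    obtain ⟨f, hf, hfc, hfz, hf0⟩ := hfool d ρ hρ0 hρ1 z
    refine ⟨f, hf, neg_mem_smoothClass hf, fun i => hf0 _ ?_, ?_⟩
    · by_contra! h
      refine hzU ⟨i, le_trans (le_of_eq ?_) h.le⟩
      exact Finset.sum_congr rfl fun j _ => by ring
    · have hz2 : 2 * ε < f z := by
        rw [hfz, hρr, mul_assoc, mul_left_comm, mul_div_cancel_left₀ _ hM0.ne']
        linarith
      have hopen : IsOpen (I ∩ {x | 2 * ε < f x}) := hIo.inter (isOpen_lt continuous_const hfc)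
      have hpos : 0 < volume (I ∩ {x | 2 * ε < f x}) := hopen.measure_pos _ ⟨z, hzI, hz2⟩
      have hsub : I ∩ {x | 2 * ε < f x} ⊆ {y | 2 * ε ≤ f y} ∩ cube d := fun x hx =>
        ⟨show 2 * ε ≤ f x from le_of_lt (show 2 * ε < f x from hx.2), hIc hx.1⟩
      exact ((hpos.trans_le (measure_mono hsub)).trans_le (Measure.le_restrict_apply _ _)).ne'
  have h1 := hge.trans (minAppError_nApp_le hr d hε)
  rw [ENNReal.ofReal_le_ofReal_iff hε.le] at h1
  linarith

/-! ### Comparison of the two complexities -/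

theorem exists_gap {r : ℕ} (hr : 1 ≤ r) : ∃ c ε₀ : ℝ, 0 < c ∧ 0 < ε₀ ∧ ∀ d : ℕ, 1 ≤ d →
    ∀ ε : ℝ, 0 < ε → ε < ε₀ →
      (c * (d : ℝ) ^ (1 / 2 - 1 / (r : ℝ))) ^ d * (nInt ε (smoothClass r d) : ℝ) ≤
        (nApp ε (smoothClass r d) : ℝ) := by
  obtain ⟨C, hC, hint⟩ := exists_nInt_le hr
  obtain ⟨c, ε₀, hc, hε₀, happ⟩ := exists_le_nApp hr
  refine ⟨c / C, min ε₀ 1, by positivity, by positivity, fun d hd ε hε hε1 => ?_⟩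
  have hd0 : (0 : ℝ) < d := by exact_mod_cast hd
  calc _ ≤ (c / C * (d : ℝ) ^ (1 / 2 - 1 / (r : ℝ))) ^ d *
        (C * (d : ℝ) ^ (1 / (r : ℝ)) * ε ^ (-(1 / (r : ℝ)))) ^ d :=
        mul_le_mul_of_nonneg_left (hint d hd ε hε (hε1.le.trans (min_le_right _ _)))
          (by positivity)
    _ = (c * √d * ε ^ (-(1 / (r : ℝ)))) ^ d := by
      rw [← mul_pow, Real.sqrt_eq_rpow, Real.rpow_sub hd0]
      congr 1
      field_simp
    _ ≤ _ := happ d hd ε hε (hε1.trans_le (min_le_left _ _))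

theorem significantlyHarder_of_gap {p q : ℕ → ℝ → ℕ} {c ε₀ s : ℝ} (hc : 0 < c) (hε₀ : 0 < ε₀)
    (hs : 0 < s) (h : ∀ d : ℕ, 1 ≤ d → ∀ ε : ℝ, 0 < ε → ε < ε₀ →
      (c * (d : ℝ) ^ s) ^ d * (q d ε : ℝ) ≤ (p d ε : ℝ)) : SignificantlyHarder p q := by
  refine ⟨ε₀, hε₀, fun K hK => ?_⟩
  have htend := (tendsto_rpow_atTop hs).comp tendsto_natCast_atTop_atTop
  obtain ⟨d₀, hd₀⟩ := Filter.eventually_atTop.1 (htend.eventually_ge_atTop (K / c))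
  refine ⟨max d₀ 1, fun d hd ε hε hε1 => ?_⟩
  refine le_trans ?_ (h d ((le_max_right _ _).trans hd) ε hε hε1)
  refine mul_le_mul_of_nonneg_right (pow_le_pow_left₀ hK.le ?_ d) (Nat.cast_nonneg _)
  have := hd₀ d ((le_max_left _ _).trans hd)
  rw [Function.comp_apply, div_le_iff₀ hc] at this
  linarith

theorem not_significantlyHarder_of_le {p q : ℕ → ℝ → ℕ} {C : ℝ} (hC : 0 < C)
    (h : ∀ d : ℕ, 1 ≤ d → ∀ ε : ℝ, 0 < ε → ε < 1 / 2 →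
      0 < q d ε ∧ (p d ε : ℝ) ≤ C ^ d * (q d ε : ℝ)) : ¬ SignificantlyHarder p q := by
  rintro ⟨ε₀, hε₀, hK⟩
  -- The factor `K = 2 * C` contradicts the bound by `C` once the positive `q d ε` is cancelled; the
  -- dimension `d₀ + 1` is nonzero, which makes the comparison of powers strict.
  obtain ⟨d₀, hd₀⟩ := hK (2 * C) (by positivity)
  have hε : 0 < min ε₀ (1 / 2) / 2 := by positivity
  have hε2 : min ε₀ (1 / 2) / 2 < min ε₀ (1 / 2) := half_lt_self (by positivity)
  have h1 := hd₀ (d₀ + 1) (Nat.le_succ _) _ hε (hε2.trans_le (min_le_left _ _))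
  obtain ⟨hq, h2⟩ := h (d₀ + 1) (Nat.le_add_left _ _) _ hε (hε2.trans_le (min_le_right _ _))
  have hq' : (0 : ℝ) < q (d₀ + 1) (min ε₀ (1 / 2) / 2) := by exact_mod_cast hq
  have h3 := le_of_mul_le_mul_right (h1.trans h2) hq'
  exact absurd h3 (not_le.2 (pow_lt_pow_left₀ (by linarith) hC.le (Nat.succ_ne_zero _)))

theorem exists_nApp_le_nInt {r : ℕ} (hr : 1 ≤ r) (hr2 : r ≤ 2) : ∃ C : ℝ, 0 < C ∧ ∀ d : ℕ, 1 ≤ d →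
    ∀ ε : ℝ, 0 < ε → ε < 1 / 2 → (nApp ε (smoothClass r d) : ℝ) ≤
      C ^ d * (nInt ε (smoothClass r d) : ℝ) := by
  obtain ⟨c, hc, hint⟩ := UniformRecovery.exists_le_nInt hr
  refine ⟨8 / c, by positivity, fun d hd ε hε hε1 => ?_⟩
  calc _ ≤ (8 * (d : ℝ) ^ (1 / (r : ℝ)) * ε ^ (-(1 / (r : ℝ)))) ^ d :=
        nApp_le hr hr2 hd hε (by linarith)
    _ = (8 / c) ^ d * (c * (d : ℝ) ^ (1 / (r : ℝ)) * ε ^ (-(1 / (r : ℝ)))) ^ d := by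
      rw [← mul_pow]
      congr 1
      field_simp
    _ ≤ _ := mul_le_mul_of_nonneg_left (hint d hd ε hε hε1) (by positivity)

end UniformRecovery

theorem mainTheorem4 (r : ℕ) (hr : 1 ≤ r) :
    -- uniform recovery is significantly harder than integration iff `r ≥ 3`
    (UniformRecovery.SignificantlyHarder
        (fun d ε => UniformRecovery.nApp ε (UniformRecovery.smoothClass r d))
        (fun d ε => UniformRecovery.nInt ε (UniformRecovery.smoothClass r d)) ↔ 3 ≤ r) ∧
    -- the complexity of integration is of order `(d / ε) ^ (d / r)`
    (∃ c C : ℝ, 0 < c ∧ 0 < C ∧ ∀ d : ℕ, 1 ≤ d → ∀ ε : ℝ, 0 < ε → ε < 1 / 2 →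
      (c * (d : ℝ) ^ (1 / (r : ℝ)) * ε ^ (-(1 / (r : ℝ)))) ^ d ≤
          (UniformRecovery.nInt ε (UniformRecovery.smoothClass r d) : ℝ) ∧
        (UniformRecovery.nInt ε (UniformRecovery.smoothClass r d) : ℝ) ≤
          (C * (d : ℝ) ^ (1 / (r : ℝ)) * ε ^ (-(1 / (r : ℝ)))) ^ d) ∧
    -- the quantitative gap for `r ≥ 3`
    (3 ≤ r → ∃ c ε₀ : ℝ, 0 < c ∧ 0 < ε₀ ∧ ∀ d : ℕ, 1 ≤ d → ∀ ε : ℝ, 0 < ε → ε < ε₀ →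
      (c * (d : ℝ) ^ (1 / 2 - 1 / (r : ℝ))) ^ d *
          (UniformRecovery.nInt ε (UniformRecovery.smoothClass r d) : ℝ) ≤
        (UniformRecovery.nApp ε (UniformRecovery.smoothClass r d) : ℝ)) ∧
    -- the two complexities are of the same order for `r ≤ 2`
    (r ≤ 2 → ∃ C : ℝ, 0 < C ∧ ∀ d : ℕ, 1 ≤ d → ∀ ε : ℝ, 0 < ε → ε < 1 / 2 →
      UniformRecovery.nInt ε (UniformRecovery.smoothClass r d) ≤
          UniformRecovery.nApp ε (UniformRecovery.smoothClass r d) ∧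
        (UniformRecovery.nApp ε (UniformRecovery.smoothClass r d) : ℝ) ≤
          C ^ d * (UniformRecovery.nInt ε (UniformRecovery.smoothClass r d) : ℝ)) := by
  obtain ⟨c, hc, hlow⟩ := UniformRecovery.exists_le_nInt hr
  obtain ⟨C, hC, hup⟩ := UniformRecovery.exists_nInt_le hr
  refine ⟨⟨fun hsig => ?_, fun h3 => ?_⟩,
    ⟨c, C, hc, hC, fun d hd ε hε hε1 => ⟨hlow d hd ε hε hε1, hup d hd ε hε (by linarith)⟩⟩,
    fun _ => UniformRecovery.exists_gap hr, fun hr2 => ?_⟩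
  · by_contra! h3
    obtain ⟨C', hC', h⟩ := UniformRecovery.exists_nApp_le_nInt hr (by omega)
    refine UniformRecovery.not_significantlyHarder_of_le hC'
      (fun d hd ε hε hε1 => ⟨?_, h d hd ε hε hε1⟩) hsig
    -- The lower bound on integration also shows that its complexity is nonzero, as the cancellation
    -- requires.
    have hpos : (0 : ℝ) < (c * (d : ℝ) ^ (1 / (r : ℝ)) * ε ^ (-(1 / (r : ℝ)))) ^ d := by
      have : (0 : ℝ) < d := by exact_mod_cast hd
      positivity
    exact_mod_cast hpos.trans_le (hlow d hd ε hε hε1)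
  · obtain ⟨c', ε₀, hc', hε₀, h⟩ := UniformRecovery.exists_gap hr
    refine UniformRecovery.significantlyHarder_of_gap hc' hε₀ ?_ h
    have h3' : (3 : ℝ) ≤ r := by exact_mod_cast h3
    rw [sub_pos]
    exact one_div_lt_one_div_of_lt two_pos (by linarith)
  · obtain ⟨C', hC', h⟩ := UniformRecovery.exists_nApp_le_nInt hr hr2
    exact ⟨C', hC', fun d hd ε hε hε1 => ⟨UniformRecovery.nInt_le_nApp hr d hε, h d hd ε hε hε1⟩⟩
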